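/- Let $\mathfrak{A}$ be a unital, simple, purely infinite C$^*$-algebra; that is, $\mathfrak A$ is a nonzero unital C$^*$-algebra with no closed two-sided ideals other than $\{0\}$ and $\mathfrak A$, and every nonzero hereditary C$^*$-subalgebra of $\mathfrak A$ contains an infinite projection (a projection $p = v^*v$ with $v \in \mathfrak A$ such that $vv^*$ is a subprojection of $p$ with $vv^* \neq p$). Let $A \in \mathfrak{A}$ be positive. Then the following are equivalent: 1. $A$ belongs to the norm closure of the set of nilpotent elements of $\mathfrak A$. 2. $A$ belongs to the norm closure of the set of quasinilpotent elements of $\mathfrak A$, that is, of the elements $T \in \mathfrak A$ with $\sigma(T) = \{0\}$. 3. The spectrum $\sigma(A)$ is connected and contains $0$. -/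

import Mathlib

/-- A C⋆-algebra is simple if it is nonzero and has no closed two-sided ideals other than
zero and itself. -/
def IsSimpleCStarAlgebra (A : Type*) [CStarAlgebra A] : Prop :=
  Nontrivial A ∧ ∀ I : TwoSidedIdeal A, IsClosed (I : Set A) → I = ⊥ ∨ I = ⊤

/-- A projection is infinite if it is Murray-von Neumann equivalent to a proper subprojection of
itself. (Since `star v * v` is a projection, so is `v * star v`.) -/
def IsInfiniteProjection {A : Type*} [CStarAlgebra A] [PartialOrder A] (p : A) : Prop :=
  IsStarProjection p ∧ ∃ v : A, star v * v = p ∧ v * star v < p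

/-- A hereditary C⋆-subalgebra: a norm-closed, not necessarily unital, ⋆-subalgebra containing
every positive element dominated by one of its elements. -/
structure IsHereditaryCStarSubalgebra {A : Type*} [CStarAlgebra A] [PartialOrder A]
    (B : NonUnitalStarSubalgebra ℂ A) : Prop where
  isClosed : IsClosed (B : Set A)
  mem_of_le : ∀ a b : A, 0 ≤ a → a ≤ b → b ∈ B → a ∈ B

/-- Pure infiniteness of a (simple) C⋆-algebra: every nonzero hereditary C⋆-subalgebra contains an
infinite projection. -/
def IsPurelyInfinite (A : Type*) [CStarAlgebra A] [PartialOrder A] : Prop :=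
  ∀ B : NonUnitalStarSubalgebra ℂ A, IsHereditaryCStarSubalgebra B → B ≠ ⊥ →
    ∃ p ∈ B, IsInfiniteProjection p

/-- The set of nilpotent elements. -/
def nilpotentElements (A : Type*) [CStarAlgebra A] : Set A :=
  {x | IsNilpotent x}

/-- The set of quasinilpotent elements, those with spectrum `{0}`. -/
def quasinilpotentElements (A : Type*) [CStarAlgebra A] : Set A :=
  {x | spectrum ℂ x = {0}}

/-!
A nilpotent is quasinilpotent, so two implications carry the content.

*Limits of quasinilpotents have connected spectrum containing `0`.* Invertibility is an open
condition, which gives `0 ∈ σ(a)`. If `σ(a)` had a gap between `0` and some spectral value `s`, take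
a circle around `s` that crosses the real line in the gap and to the right of `σ(a)`. The
resolvents of quasinilpotents close to `a` are uniformly bounded on the circle and holomorphic
inside it, so by the maximum principle they are uniformly bounded at `s`, and `s - a` is invertible:
`mem_spectrum_of_mem_closure_quasinilpotentElements`.

*If `σ(a) = [0, ‖a‖]`, then `a` is a limit of nilpotents.* Three facts are combined.

* In a simple, purely infinite algebra every nonzero projection dominates infinitely many orthogonal
  copies of the identity (`exists_orthogonal_isometries_under`), and self-adjoint elements
  can be perturbed so that their spectrum avoids finitely many given points
  (`exists_isSelfAdjoint_notMem_spectrum`). Hence `a` is close to `∑ k h Pₖ` for a small mesh `h`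
  and orthogonal projections `Pₖ`, none of which vanishes because `σ(a)` has no gaps.
* There are nilpotent matrices arbitrarily close to positive diagonal matrices with largest entry
  `1` (`exists_diagonal_near_isNilpotent`). Most diagonal entries must then be close to `0`, since
  nilpotents have trace zero. They are obtained from Toeplitz matrices with symbol
  `-δ log (1 - r z)`, which maps the disc into a thin neighbourhood of a half-line.
* A projection at the top level of `∑ k h Pₖ` has, below each of the lower `Pₖ`, as many copies as
  such a matrix asks for. The matrix algebra on these copies carries a nilpotent close to the
  corresponding part of `∑ k h Pₖ`, and what remains has one level less. Since the parts are
  orthogonal, the errors do not add up in the induction (`exists_isNilpotent_near_sum`).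
-/

/-! ### Projections and isometries in simple, purely infinite algebras -/

section PurelyInfinite

variable {A : Type*} [CStarAlgebra A]

/-- The two-sided annihilator of a self-adjoint element, as a `⋆`-subalgebra. -/
def annihilatorStarSubalgebra (k : A) (hk : IsSelfAdjoint k) : NonUnitalStarSubalgebra ℂ A where
  carrier := {x | k * x = 0 ∧ x * k = 0}
  add_mem' := by
    rintro x y ⟨hx, hx'⟩ ⟨hy, hy'⟩
    exact ⟨by rw [mul_add, hx, hy, add_zero], by rw [add_mul, hx', hy', add_zero]⟩
  zero_mem' := ⟨mul_zero k, zero_mul k⟩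
  mul_mem' := by
    rintro x y ⟨hx, hx'⟩ ⟨hy, hy'⟩
    exact ⟨by rw [← mul_assoc, hx, zero_mul], by rw [mul_assoc, hy', mul_zero]⟩
  smul_mem' := by
    rintro c x ⟨hx, hx'⟩
    exact ⟨by rw [mul_smul_comm, hx, smul_zero], by rw [smul_mul_assoc, hx', smul_zero]⟩
  star_mem' := by
    rintro x ⟨hx, hx'⟩
    refine ⟨?_, ?_⟩
    · simpa [hk.star_eq] using congrArg star hx'
    · simpa [hk.star_eq] using congrArg star hx

lemma star_mul_mul_mem_cone {e c : A}
    (hc : c ∈ AddSubmonoid.closure (Set.range fun x : A => star x * e * x)) (b : A) :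
    star b * c * b ∈ AddSubmonoid.closure (Set.range fun x : A => star x * e * x) := by
  induction hc using AddSubmonoid.closure_induction with
  | mem x h =>
    obtain ⟨x, rfl⟩ := h
    exact AddSubmonoid.subset_closure ⟨x * b, by simp [mul_assoc]⟩
  | zero => simp
  | add x y _ _ hx hy => rw [mul_add, add_mul]; exact add_mem hx hy

variable [PartialOrder A] [StarOrderedRing A]

lemma isHereditary_annihilatorStarSubalgebra (k : A) (hk : IsSelfAdjoint k) :
    IsHereditaryCStarSubalgebra (annihilatorStarSubalgebra k hk) where
  isClosed := (isClosed_eq (continuous_const.mul continuous_id) continuous_const).inter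
    (isClosed_eq (continuous_id.mul continuous_const) continuous_const)
  mem_of_le := by
    rintro a b ha hab ⟨-, hb⟩
    -- `k a k ≤ k b k = 0`, so `√a k` vanishes by the C⋆-identity.
    have h1 : k * a * k ≤ 0 := by
      have := star_left_conjugate_le_conjugate hab k
      rwa [hk.star_eq, mul_assoc k b, hb, mul_zero] at this
    have h2 : k * a * k = 0 := by
      refine le_antisymm h1 ?_
      have := star_left_conjugate_nonneg ha k
      rwa [hk.star_eq] at this
    have h3 : CFC.sqrt a * k = 0 := by
      rw [← CStarRing.star_mul_self_eq_zero_iff, star_mul, hk.star_eq,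
        (CFC.sqrt_nonneg a).isSelfAdjoint.star_eq, mul_assoc, ← mul_assoc (CFC.sqrt a),
        CFC.sqrt_mul_sqrt_self a, ← mul_assoc, h2]
    have h4 : a * k = 0 := by
      rw [← CFC.sqrt_mul_sqrt_self a, mul_assoc, h3, mul_zero]
    refine ⟨?_, h4⟩
    simpa [hk.star_eq, ha.isSelfAdjoint.star_eq] using congrArg star h4

/-- Pure infiniteness is used only through hereditary subalgebras that are annihilators. -/
lemma IsPurelyInfinite.exists_isInfiniteProjection (hpi : IsPurelyInfinite A) {k x : A}
    (hk : IsSelfAdjoint k) (hx : x ≠ 0) (hkx : k * x = 0) (hxk : x * k = 0) :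
    ∃ p : A, IsInfiniteProjection p ∧ k * p = 0 ∧ p * k = 0 := by
  obtain ⟨p, hp, hp'⟩ := hpi _ (isHereditary_annihilatorStarSubalgebra k hk) (by
    intro h
    have : x ∈ annihilatorStarSubalgebra k hk := ⟨hkx, hxk⟩
    rw [h] at this
    exact hx (NonUnitalStarAlgebra.mem_bot.1 this))
  exact ⟨p, hp', hp⟩

lemma IsInfiniteProjection.ne_zero {p : A} (hp : IsInfiniteProjection p) : p ≠ 0 := by
  rintro rfl
  obtain ⟨-, v, -, hv⟩ := hp
  exact absurd (mul_star_self_nonneg v) (not_le_of_gt hv)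

/-- Elements dominated by the cone generated by the `x⋆ e x`. Because
`(s + t)⋆ (s + t) ≤ 2 (s⋆ s + t⋆ t)`, they form a two-sided ideal. -/
def dominatedSet (e : A) : Set A :=
  {s | ∃ c ∈ AddSubmonoid.closure (Set.range fun x : A => star x * e * x), star s * s ≤ c}

lemma add_mem_dominatedSet {e s t : A} (hs : s ∈ dominatedSet e) (ht : t ∈ dominatedSet e) :
    s + t ∈ dominatedSet e := by
  obtain ⟨c, hc, hsc⟩ := hs
  obtain ⟨d, hd, htd⟩ := ht
  refine ⟨(c + d) + (c + d), add_mem (add_mem hc hd) (add_mem hc hd), ?_⟩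
  have h : star (s + t) * (s + t) ≤
      star s * s + star t * t + (star s * s + star t * t) := by
    have := star_mul_self_nonneg (s - t)
    rw [← sub_nonneg]
    convert this using 1
    simp only [star_add, star_sub]
    noncomm_ring
  exact h.trans (add_le_add (add_le_add hsc htd) (add_le_add hsc htd))

lemma mul_mem_dominatedSet_left {e s : A} (a : A) (hs : s ∈ dominatedSet e) :
    a * s ∈ dominatedSet e := by
  obtain ⟨c, hc, hsc⟩ := hs
  obtain ⟨n, hn⟩ := exists_nat_ge (‖a‖ ^ 2)
  refine ⟨n • c, nsmul_mem hc n, ?_⟩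
  have h1 : star a * a ≤ algebraMap ℝ A n :=
    CStarAlgebra.star_mul_le_algebraMap_norm_sq.trans (algebraMap_mono A hn)
  have h2 := star_left_conjugate_le_conjugate h1 s
  have h3 : star (a * s) * (a * s) ≤ n • (star s * s) := by
    convert h2 using 1
    · simp [mul_assoc]
    · simp [nsmul_eq_mul, mul_assoc]
      rw [← mul_assoc, (Nat.cast_commute n (star s)).eq, mul_assoc]
  exact h3.trans (nsmul_le_nsmul_right hsc n)

lemma mul_mem_dominatedSet_right {e s : A} (b : A) (hs : s ∈ dominatedSet e) :
    s * b ∈ dominatedSet e := by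
  obtain ⟨c, hc, hsc⟩ := hs
  refine ⟨_, star_mul_mul_mem_cone hc b, ?_⟩
  convert star_left_conjugate_le_conjugate hsc b using 1
  simp [mul_assoc]

/-- In a simple unital C⋆-algebra a nonzero projection `e` is algebraically full, in the strong
form `1 = ∑ xᵢ⋆ e xᵢ`. -/
lemma IsSimpleCStarAlgebra.one_mem_cone (hs : IsSimpleCStarAlgebra A) {e : A}
    (he : IsStarProjection e) (he0 : e ≠ 0) :
    (1 : A) ∈ AddSubmonoid.closure (Set.range fun x : A => star x * e * x) := by
  let I : TwoSidedIdeal A := TwoSidedIdeal.mk' (closure (dominatedSet e))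
    (subset_closure ⟨0, zero_mem _, by simp⟩)
    (fun hx hy => map_mem_closure₂ continuous_add hx hy fun _ h _ h' => add_mem_dominatedSet h h')
    (fun {x} hx => map_mem_closure continuous_neg hx fun y h => by
      rw [← neg_one_mul]; exact mul_mem_dominatedSet_left _ h)
    (fun {x y} hy => map_mem_closure (f := fun z => x * z) (continuous_const_mul x) hy
      fun z h => mul_mem_dominatedSet_left x h)
    (fun {x y} hx => map_mem_closure (f := fun z => z * y) (continuous_mul_const y) hx
      fun z h => mul_mem_dominatedSet_right y h)
  have hI : ∀ x, x ∈ I ↔ x ∈ closure (dominatedSet e) := fun x => TwoSidedIdeal.mem_mk' ..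
  have hIc : (I : Set A) = closure (dominatedSet e) := Set.ext hI
  have heI : e ∈ I := (hI e).2 <| subset_closure
    ⟨e, AddSubmonoid.subset_closure ⟨1, by simp⟩, by
      rw [he.isSelfAdjoint.star_eq, he.isIdempotentElem.eq]⟩
  have hone : (1 : A) ∈ closure (dominatedSet e) := by
    rcases hs.2 I (by rw [hIc]; exact isClosed_closure) with h | h
    · rw [h] at heI
      exact absurd (by simpa using heI) he0
    · rw [← hI, h]; trivial
  have hopen : IsOpen {x : A | IsUnit x} := Units.isOpen
  obtain ⟨s, hsu, c, hc, hsc⟩ := mem_closure_iff.1 hone _ hopen isUnit_one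
  -- The cone contains a strictly positive `c`; conjugate it by `c ^ (-1/2)`.
  have hpos : IsStrictlyPositive c := by
    refine IsStrictlyPositive.of_le ?_ hsc
    exact ⟨star_mul_self_nonneg s, hsu.star.mul hsu⟩
  have := star_mul_mul_mem_cone hc (c ^ (-(1 / 2) : ℝ))
  rwa [(CFC.rpow_nonneg (a := c)).isSelfAdjoint.star_eq,
    CFC.conjugate_rpow_neg_one_half c hpos] at this

/-- A witness of infiniteness in the form used below: `v` maps `p` into itself and misses a
nonzero subprojection `e`. -/
lemma IsInfiniteProjection.exists_shift {p : A} (hp : IsInfiniteProjection p) :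
    ∃ v e : A, star v * v = p ∧ p * v = v ∧ IsStarProjection e ∧ e ≠ 0 ∧ p * e = e ∧
      e * v = 0 := by
  obtain ⟨hpp, v, hv, hlt⟩ := hp
  have hvp : v * p = v := by
    have h0 : star (v * (1 - p)) * (v * (1 - p)) = 0 := by
      rw [star_mul, mul_assoc, ← mul_assoc (star v), hv, hpp.mul_one_sub_self, mul_zero]
    have := (CStarRing.star_mul_self_eq_zero_iff _).1 h0
    rw [mul_sub, mul_one, sub_eq_zero] at this
    exact this.symm
  have hvv : IsStarProjection (v * star v) := by
    refine ⟨?_, IsSelfAdjoint.mul_star_self v⟩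
    change v * star v * (v * star v) = _
    rw [mul_assoc, ← mul_assoc (star v), hv, ← mul_assoc, hvp]
  have hpv : p * (v * star v) = v * star v := (hpp.mul_right_and_mul_left_of_nonneg_of_le
    (mul_star_self_nonneg v) hlt.le).2
  have hpv' : p * v = v := by
    calc p * v = p * (v * p) := by rw [hvp]
      _ = p * (v * star v) * v := by rw [← hv]; simp only [mul_assoc]
      _ = v := by rw [hpv, mul_assoc, hv, hvp]
  refine ⟨v, p - v * star v, hv, hpv', hvv.sub_of_mul_eq_right hpp hpv,
    sub_ne_zero.2 hlt.ne', ?_, ?_⟩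
  · rw [mul_sub, hpv, hpp.isIdempotentElem.eq]
  · rw [sub_mul, hpv', mul_assoc, hv, hvp, sub_self]

/-- An infinite projection in a simple unital C⋆-algebra dominates a copy of the identity. With
`v⋆ v = p` and `e ≤ p - v v⋆`, the expression `1 = ∑ xᵢ⋆ e xᵢ` is turned into the isometry
`∑ vⁱ e xᵢ`, whose terms have orthogonal ranges below `p`. -/
lemma IsInfiniteProjection.exists_isometry (hs : IsSimpleCStarAlgebra A) {p : A}
    (hp : IsInfiniteProjection p) : ∃ w : A, star w * w = 1 ∧ p * w = w := by
  obtain ⟨v, e, hv, hpv, he, he0, hpe, hev⟩ := hp.exists_shift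
  have hve : star v * e = 0 := by
    simpa [he.isSelfAdjoint.star_eq] using congrArg star hev
  have key : ∀ c ∈ AddSubmonoid.closure (Set.range fun x : A => star x * e * x),
      ∃ w : A, star w * w = c ∧ p * w = w := by
    intro c hc
    induction hc using AddSubmonoid.closure_induction_left with
    | zero => exact ⟨0, by simp, by simp⟩
    | add_left x hx y _ ih =>
      obtain ⟨x, rfl⟩ := hx
      obtain ⟨w, hw, hpw⟩ := ih
      refine ⟨e * x + v * w, ?_, ?_⟩
      · calc star (e * x + v * w) * (e * x + v * w)
            = star x * (e * e) * x + star x * (e * v) * w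
              + star w * (star v * e) * x + star w * (star v * v * w) := by
              rw [star_add, star_mul, star_mul, he.isSelfAdjoint.star_eq]
              noncomm_ring
          _ = _ := by
              rw [hev, hve, hv, he.isIdempotentElem.eq, hpw, hw]
              simp
      · rw [mul_add, ← mul_assoc, hpe, ← mul_assoc, hpv]
  exact key 1 (hs.one_mem_cone he he0)

lemma IsPurelyInfinite.exists_isInfiniteProjection_le (hpi : IsPurelyInfinite A) {p : A}
    (hp : IsStarProjection p) (hp0 : p ≠ 0) : ∃ q, IsInfiniteProjection q ∧ p * q = q := by
  obtain ⟨q, hq, h, -⟩ := hpi.exists_isInfiniteProjection hp.one_sub.isSelfAdjoint hp0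
    hp.one_sub_mul_self hp.mul_one_sub_self
  refine ⟨q, hq, ?_⟩
  rw [sub_mul, one_mul, sub_eq_zero] at h
  exact h.symm

lemma exists_isometry_under (hs : IsSimpleCStarAlgebra A) (hpi : IsPurelyInfinite A) {p : A}
    (hp : IsStarProjection p) (hp0 : p ≠ 0) : ∃ w : A, star w * w = 1 ∧ p * w = w := by
  obtain ⟨q, hq, hpq⟩ := hpi.exists_isInfiniteProjection_le hp hp0
  obtain ⟨w, hw, hqw⟩ := hq.exists_isometry hs
  exact ⟨w, hw, by rw [← hqw, ← mul_assoc, hpq]⟩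

/-- Below any nonzero projection of a simple, purely infinite unital C⋆-algebra there are
infinitely many pairwise orthogonal copies of the identity. -/
lemma exists_orthogonal_isometries_under (hs : IsSimpleCStarAlgebra A) (hpi : IsPurelyInfinite A)
    {p : A} (hp : IsStarProjection p) (hp0 : p ≠ 0) :
    ∃ u : ℕ → A, (∀ i j, star (u i) * u j = if i = j then 1 else 0) ∧ ∀ i, p * u i = u i := by
  obtain ⟨q, hq, hpq⟩ := hpi.exists_isInfiniteProjection_le hp hp0
  obtain ⟨v, e, hv, hqv, he, he0, hqe, hev⟩ := hq.exists_shift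
  obtain ⟨s, hs1, hes⟩ := exists_isometry_under hs hpi he he0
  obtain ⟨w, hw1, hqw⟩ := hq.exists_isometry hs
  have hps : p * s = s := by rw [← hes, ← hqe, ← mul_assoc, ← mul_assoc, hpq]
  have hpv : p * v = v := by rw [← hqv, ← mul_assoc, hpq]
  have ht1 : star (v * w) * (v * w) = 1 := by
    rw [star_mul, mul_assoc, ← mul_assoc (star v), hv, hqw, hw1]
  have hst : star s * (v * w) = 0 := by
    rw [← hes, star_mul, he.isSelfAdjoint.star_eq, mul_assoc, ← mul_assoc e, hev, zero_mul,
      mul_zero]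
  have hts : star (v * w) * s = 0 := by simpa using congrArg star hst
  have hpt : p * (v * w) = v * w := by rw [← mul_assoc, hpv]
  -- Both `s` and the isometry `t = v w` lie below `p`, with orthogonal ranges; take `tⁱ s`.
  generalize v * w = t at ht1 hst hts hpt
  have hpow : ∀ n, star (t ^ n) * t ^ n = 1 := by
    intro n
    induction n with
    | zero => simp
    | succ n ih =>
      rw [pow_succ', star_mul, mul_assoc, ← mul_assoc (star t), ht1, one_mul, ih]
  have horth : ∀ i k, star (t ^ i * s) * (t ^ (i + k + 1) * s) = 0 := by
    intro i k
    rw [star_mul, add_assoc, pow_add, mul_assoc, ← mul_assoc (star (t ^ i)),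
      ← mul_assoc (star (t ^ i)), hpow, one_mul, pow_succ', ← mul_assoc, ← mul_assoc, hst,
      zero_mul, zero_mul]
  refine ⟨fun i => t ^ i * s, fun i j => ?_, fun i => ?_⟩
  · beta_reduce
    rcases lt_trichotomy i j with h | rfl | h
    · obtain ⟨k, rfl⟩ := Nat.exists_eq_add_of_lt h
      rw [if_neg h.ne, horth]
    · rw [if_pos rfl, star_mul, mul_assoc, ← mul_assoc (star (t ^ i)), hpow, one_mul, hs1]
    · obtain ⟨k, rfl⟩ := Nat.exists_eq_add_of_lt h
      rw [if_neg h.ne']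
      simpa using congrArg star (horth j k)
  · beta_reduce
    cases i with
    | zero => simpa using hps
    | succ i => rw [pow_succ', ← mul_assoc, ← mul_assoc, hpt]

lemma IsSelfAdjoint.isUnit_of_mul_eq_one {B : Type*} [Monoid B] [StarMul B] {x y : B}
    (hx : IsSelfAdjoint x) (h : x * y = 1) : IsUnit x := by
  have h' : star y * x = 1 := by simpa [hx.star_eq] using congrArg star h
  exact ⟨⟨x, y, h, left_inv_eq_right_inv h' h ▸ h'⟩, rfl⟩

/-- Self-adjoint elements can be moved off a prescribed real spectral value. After a soft threshold
`b` is replaced by some `k` annihilated by a nonzero projection `p`; a partial isometry `w` from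
`1 - p` into `p` then makes `k + δ (w + w⋆)` invertible, in the manner of the matrix
`[[k, δ], [δ, 0]]`. -/
lemma exists_isSelfAdjoint_isUnit (hs : IsSimpleCStarAlgebra A) (hpi : IsPurelyInfinite A)
    {b : A} (hb : IsSelfAdjoint b) {η : ℝ} (hη : 0 < η) :
    ∃ b' : A, IsSelfAdjoint b' ∧ ‖b - b'‖ < η ∧ IsUnit b' := by
  by_cases hu : IsUnit b
  · exact ⟨b, hb, by simpa using hη, hu⟩
  have h0 : (0 : ℝ) ∈ spectrum ℝ b := by rwa [spectrum.zero_mem_iff]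
  -- `x ↦ max (-c) (min c x)` is the part of `b` that the soft threshold removes.
  obtain ⟨c, hc, hcη⟩ : ∃ c : ℝ, 0 < c ∧ c < η / 2 := ⟨η / 4, by linarith, by linarith⟩
  obtain ⟨k, hk⟩ : ∃ k : A, k = cfc (fun x : ℝ => x - max (-c) (min c x)) b := ⟨_, rfl⟩
  have hksa : IsSelfAdjoint k := hk ▸ cfc_predicate _ b
  have hbk : ‖b - k‖ ≤ c := by
    have : b - k = cfc (fun x : ℝ => max (-c) (min c x)) b := by
      rw [hk]
      nth_rewrite 1 [← cfc_id ℝ b]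
      rw [← cfc_sub _ _ b]
      congr 1
      ext x
      simp
    rw [this]
    refine norm_cfc_le hc.le fun x _ => ?_
    rw [Real.norm_eq_abs, abs_le]
    exact ⟨le_max_left _ _, max_le (by linarith) (min_le_left _ _)⟩
  -- The tent function supported in `[-c, c]` witnesses that the annihilator of `k` is nonzero.
  have hf0 : cfc (fun x : ℝ => max 0 (c - |x|)) b ≠ 0 := by
    intro h
    have h1 : (fun x : ℝ => max 0 (c - |x|)) 0 ∈
        spectrum ℝ (cfc (fun x : ℝ => max 0 (c - |x|)) b) := by
      rw [cfc_map_spectrum (fun x : ℝ => max 0 (c - |x|)) b]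
      exact ⟨0, h0, rfl⟩
    have := hs.1
    rw [h, spectrum.zero_eq] at h1
    simp at h1
    linarith
  have hmul : ∀ x : ℝ, (x - max (-c) (min c x)) * max 0 (c - |x|) = 0 := by
    intro x
    rcases le_total c |x| with h | h
    · rw [max_eq_left (b := c - |x|) (by linarith), mul_zero]
    · obtain ⟨h1, h2⟩ := abs_le.1 h
      rw [min_eq_right h2, max_eq_right h1, sub_self, zero_mul]
  have hkf : k * cfc (fun x : ℝ => max 0 (c - |x|)) b = 0 := by
    rw [hk, ← cfc_mul _ _ b]
    simp only [hmul]
    exact cfc_const_zero ℝ b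
  have hfk : cfc (fun x : ℝ => max 0 (c - |x|)) b * k = 0 := by
    rw [hk, ← cfc_mul _ _ b]
    simp only [mul_comm (max _ _), hmul]
    exact cfc_const_zero ℝ b
  obtain ⟨p, hp, hkp, hpk⟩ := hpi.exists_isInfiniteProjection hksa hf0 hkf hfk
  have hpp := hp.1
  obtain ⟨v, hv1, hpv⟩ := exists_isometry_under hs hpi hpp hp.ne_zero
  have hp2 : p * p = p := hpp.isIdempotentElem.eq
  have hps : star p = p := hpp.isSelfAdjoint.star_eq
  obtain ⟨w, hw⟩ : ∃ w : A, w = v * (1 - p) := ⟨_, rfl⟩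
  have hww : star w * w = 1 - p := by
    rw [hw, star_mul, mul_assoc, ← mul_assoc (star v), hv1, one_mul,
      hpp.one_sub.isSelfAdjoint.star_eq, hpp.one_sub.isIdempotentElem.eq]
  have hpw : p * w = w := by rw [hw, ← mul_assoc, hpv]
  have hwp : w * p = 0 := by rw [hw, mul_assoc, hpp.one_sub_mul_self, mul_zero]
  have hw2 : w * w = 0 := by
    calc w * w = w * (p * w) := by rw [hpw]
      _ = 0 := by rw [← mul_assoc, hwp, zero_mul]
  have hsp : star w * p = star w := by simpa [hps] using congrArg star hpw
  have hps' : p * star w = 0 := by simpa [hps] using congrArg star hwp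
  have hs2 : star w * star w = 0 := by simpa using congrArg star hw2
  have hkw : k * w = 0 := by rw [← hpw, ← mul_assoc, hkp, zero_mul]
  -- On the corner of `p - w w⋆`, which `w` does not reach, `δ` times the identity is added.
  obtain ⟨z, hz⟩ : ∃ z : A, z = w + star w + (p - w * star w) := ⟨_, rfl⟩
  obtain ⟨δ, hδ, hδz⟩ : ∃ δ : ℝ, 0 < δ ∧ δ * ‖z‖ < η / 2 := by
    refine ⟨η / 2 / (‖z‖ + 1), by positivity, ?_⟩
    rw [div_mul_eq_mul_div, div_lt_iff₀ (by positivity)]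
    nlinarith [norm_nonneg z]
  have hzsa : IsSelfAdjoint z := by
    rw [hz, IsSelfAdjoint]
    simp only [star_add, star_sub, star_star, star_mul, hps]
    abel
  have hsa' : IsSelfAdjoint (k + δ • z) := hksa.add (.smul (.all δ) hzsa)
  refine ⟨k + δ • z, hsa', ?_, ?_⟩
  · calc ‖b - (k + δ • z)‖ = ‖(b - k) - δ • z‖ := by rw [sub_add_eq_sub_sub]
      _ ≤ ‖b - k‖ + ‖δ • z‖ := norm_sub_le _ _
      _ < η := by
        rw [norm_smul, Real.norm_of_nonneg hδ.le]; linarith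
  · have hwww : w * star w * w = w := by rw [mul_assoc, hww, mul_sub, mul_one, hwp, sub_zero]
    have hwws : star w * (w * star w) = star w := by
      rw [← mul_assoc, hww, sub_mul, one_mul, hps', sub_zero]
    have hrw : (p - w * star w) * w = 0 := by rw [sub_mul, hpw, hwww, sub_self]
    have hrs : (p - w * star w) * star w = 0 := by
      rw [sub_mul, hps', mul_assoc, hs2, mul_zero, sub_zero]
    have hwr : w * (p - w * star w) = 0 := by
      rw [mul_sub, hwp, ← mul_assoc, hw2, zero_mul, sub_zero]
    have hsr : star w * (p - w * star w) = 0 := by rw [mul_sub, hsp, hwws, sub_self]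
    have hrr : (p - w * star w) * (p - w * star w) = p - w * star w := by
      rw [mul_sub, ← mul_assoc, hrw, zero_mul, sub_zero, sub_mul, hp2, mul_assoc, hsp]
    have hzz : z * z = 1 := by
      rw [hz]
      simp only [mul_add, add_mul, hw2, hs2, hrw, hrs, hwr, hsr, hrr, hww]
      abel
    have hkz : k * z = k * star w := by
      rw [hz, mul_add, mul_add, hkw, zero_add, mul_sub, hkp, ← mul_assoc, hkw, zero_mul, sub_zero,
        add_zero]
    have hzw : z * w = 1 - p := by
      rw [hz, add_mul, add_mul, hw2, hww, hrw, zero_add, add_zero]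
    -- The inverse copies that of `[[k, δ], [δ, 0]]`, which is `[[0, δ⁻¹], [δ⁻¹, -δ⁻² k]]`.
    refine hsa'.isUnit_of_mul_eq_one (y := δ⁻¹ • z - (δ⁻¹ * δ⁻¹) • (w * k * star w)) ?_
    have h1 : z * (w * k * star w) = k * star w := by
      rw [← mul_assoc, ← mul_assoc, hzw, sub_mul, one_mul, hpk, sub_zero]
    have h2 : k * (w * k * star w) = 0 := by
      rw [← mul_assoc, ← mul_assoc, hkw, zero_mul, zero_mul]
    have hδ1 : δ⁻¹ * δ = 1 := inv_mul_cancel₀ hδ.ne'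
    have hδ2 : δ⁻¹ * δ⁻¹ * δ = δ⁻¹ := by rw [mul_assoc, hδ1, mul_one]
    simp only [mul_sub, add_mul, mul_smul_comm, smul_mul_assoc, hzz, hkz, h1, h2, smul_add,
      smul_smul, zero_add, hδ1, hδ2, one_smul]
    abel

/-- A self-adjoint element can be perturbed so that finitely many prescribed reals leave its
spectrum. -/
lemma exists_isSelfAdjoint_notMem_spectrum (hs : IsSimpleCStarAlgebra A) (hpi : IsPurelyInfinite A)
    {b : A} (hb : IsSelfAdjoint b) (F : Finset ℝ) {η : ℝ} (hη : 0 < η) :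
    ∃ b' : A, IsSelfAdjoint b' ∧ ‖b - b'‖ < η ∧ ∀ t ∈ F, t ∉ spectrum ℝ b' := by
  induction F using Finset.induction_on with
  | empty => exact ⟨b, hb, by simpa using hη, by simp⟩
  | insert t F _ ih =>
    obtain ⟨b₁, hb₁, hbb, hF⟩ := ih
    have hopen : IsOpen {x : A | ∀ t ∈ F, t ∉ spectrum ℝ x} := by
      simp only [Set.ofPred_forall, spectrum.mem_iff, not_not]
      exact isOpen_biInter_finset fun t _ =>
        Units.isOpen.preimage (continuous_const.sub continuous_id)
    obtain ⟨r, hr, hball⟩ := Metric.isOpen_iff.1 hopen b₁ hF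
    obtain ⟨c, hc, hcd, hcu⟩ := exists_isSelfAdjoint_isUnit hs hpi
      (hb₁.sub (IsSelfAdjoint.algebraMap A (IsSelfAdjoint.all t)))
      (lt_min hr (sub_pos.2 hbb))
    have hd : ‖b₁ - (c + algebraMap ℝ A t)‖ < min r (η - ‖b - b₁‖) := by
      rwa [sub_add_eq_sub_sub_swap]
    refine ⟨c + algebraMap ℝ A t, hc.add (IsSelfAdjoint.algebraMap A (IsSelfAdjoint.all t)), ?_, ?_⟩
    · have := norm_sub_le_norm_sub_add_norm_sub b b₁ (c + algebraMap ℝ A t)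
      have := hd.trans_le (min_le_right _ _)
      linarith
    · intro s hs
      rcases Finset.mem_insert.1 hs with rfl | hs
      · rw [spectrum.mem_iff, not_not, sub_add_cancel_right]
        exact hcu.neg
      · refine hball ?_ s hs
        rw [Metric.mem_ball, dist_comm, dist_eq_norm]
        exact hd.trans_le (min_le_left _ _)

end PurelyInfinite

/-! ### Nilpotent matrices close to positive diagonal matrices -/

section NilpotentMatrix

open scoped Matrix Matrix.Norms.L2Operator ComplexOrder

/-- A polynomial without constant term mapping the unit circle into a thin neighbourhood of the
half-line `[0, ∞)`, with a large value at `1`: a truncation of `-δ log (1 - r z)` with `δ` small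
and then `r` close to `1`. -/
lemma exists_thin_polynomial {ε : ℝ} (hε : 0 < ε) :
    ∃ (n : ℕ) (c : ℕ → ℝ), c 0 = 0 ∧ (∀ j, 0 ≤ c j) ∧ 2 < ∑ j ∈ Finset.range n, c j ∧
      ∀ z : ℂ, ‖z‖ = 1 → |(∑ j ∈ Finset.range n, (c j : ℂ) * z ^ j).im| ≤ ε ∧
        -ε ≤ (∑ j ∈ Finset.range n, (c j : ℂ) * z ^ j).re := by
  obtain ⟨δ, hδ, hδε⟩ : ∃ δ : ℝ, 0 < δ ∧ 5 * δ = ε := ⟨ε / 5, by positivity, by ring⟩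
  -- This `r` makes `-δ log (1 - r)` equal to `2 + 2 δ`, which exceeds `2` by more than the error.
  obtain ⟨r, hr⟩ : ∃ r : ℝ, r = 1 - Real.exp (-(2 / δ + 2)) := ⟨_, rfl⟩
  have hr1 : r < 1 := by rw [hr]; linarith [Real.exp_pos (-(2 / δ + 2))]
  have hr0 : 0 ≤ r := by
    rw [hr, sub_nonneg, Real.exp_le_one_iff]
    have : 0 < 2 / δ := by positivity
    linarith
  obtain ⟨n, hn⟩ : ∃ n : ℕ, r ^ n < 1 - r :=
    exists_pow_lt_of_lt_one (by linarith) hr1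
  have tail : ∀ z : ℂ, ‖z‖ = 1 →
      ‖Complex.log (1 + -(r * z)) +
        ∑ j ∈ Finset.range (n + 1), (((r ^ j / j : ℝ) : ℂ)) * z ^ j‖ ≤ 1 := by
    intro z hz
    have hnorm : ‖-((r : ℂ) * z)‖ = r := by
      rw [norm_neg, norm_mul, hz, mul_one, Complex.norm_real, Real.norm_of_nonneg hr0]
    have h := Complex.norm_log_sub_logTaylor_le n (z := -(r * z)) (by rwa [hnorm])
    rw [hnorm] at h
    have hT : Complex.logTaylor (n + 1) (-(r * z)) =
        -∑ j ∈ Finset.range (n + 1), (((r ^ j / j : ℝ) : ℂ)) * z ^ j := by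
      rw [Complex.logTaylor, ← Finset.sum_neg_distrib]
      refine Finset.sum_congr rfl fun j _ => ?_
      rw [neg_pow (_ * z), ← mul_assoc, ← pow_add, mul_pow, Odd.neg_one_pow ⟨j, by ring⟩]
      push_cast
      ring
    rw [hT, sub_neg_eq_add] at h
    refine h.trans ?_
    have h1 : r ^ (n + 1) ≤ 1 - r := by
      have := pow_le_pow_of_le_one hr0 hr1.le (Nat.le_add_right n 1)
      linarith
    rw [← div_eq_mul_inv, div_div, div_le_one (by nlinarith [(n.cast_nonneg : (0:ℝ) ≤ n)])]
    nlinarith [(n.cast_nonneg : (0:ℝ) ≤ n)]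
  have hfac : ∀ z : ℂ, ∑ j ∈ Finset.range (n + 1), ((δ * (r ^ j / j) : ℝ) : ℂ) * z ^ j =
      δ * ∑ j ∈ Finset.range (n + 1), (((r ^ j / j : ℝ) : ℂ)) * z ^ j := by
    intro z
    rw [Finset.mul_sum]
    refine Finset.sum_congr rfl fun j _ => ?_
    push_cast
    ring
  refine ⟨n + 1, fun j => δ * (r ^ j / j), by simp, fun j => by positivity, ?_, ?_⟩
  · have h := (Complex.abs_re_le_norm _).trans (tail 1 (by simp))
    have hlog : Complex.log (1 + -(r * 1)) = ((-(2 / δ + 2) : ℝ) : ℂ) := by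
      have : (1 + -((r : ℂ) * 1)) = ((Real.exp (-(2 / δ + 2)) : ℝ) : ℂ) := by
        rw [hr]; push_cast; ring
      rw [this, ← Complex.ofReal_log (Real.exp_pos _).le, Real.log_exp]
    rw [hlog] at h
    simp only [one_pow, mul_one] at h
    rw [← Complex.ofReal_sum, ← Complex.ofReal_add, Complex.ofReal_re] at h
    have h2 := (abs_le.1 h).1
    rw [← Finset.mul_sum]
    have h3 : 2 / δ + 1 ≤ ∑ j ∈ Finset.range (n + 1), r ^ j / j := by linarith
    calc (2 : ℝ) < δ * (2 / δ + 1) := by rw [mul_add, mul_div_cancel₀ _ hδ.ne']; linarith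
      _ ≤ _ := mul_le_mul_of_nonneg_left h3 hδ.le
  · intro z hz
    rw [hfac]
    have h := tail z hz
    generalize ∑ j ∈ Finset.range (n + 1), (((r ^ j / j : ℝ) : ℂ)) * z ^ j = S at h
    have him := (Complex.abs_im_le_norm _).trans h
    have hre := (Complex.abs_re_le_norm _).trans h
    rw [Complex.add_im, abs_le] at him
    rw [Complex.add_re, abs_le, Complex.log_re] at hre
    have harg : |(Complex.log (1 + -(r * z))).im| ≤ Real.pi := by
      rw [Complex.log_im]; exact Complex.abs_arg_le_pi _
    rw [abs_le] at harg
    have hpi := Real.pi_le_four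
    have hn2 : ‖1 + -((r : ℂ) * z)‖ ≤ 2 := by
      refine (norm_add_le _ _).trans ?_
      rw [norm_neg, norm_mul, hz, mul_one, Complex.norm_real, Real.norm_of_nonneg hr0, norm_one]
      linarith
    have hlog2 : Real.log ‖1 + -((r : ℂ) * z)‖ ≤ 1 := by
      have := Real.log_le_sub_one_of_pos (x := ‖1 + -((r : ℂ) * z)‖) (by
        rw [norm_pos_iff]
        intro h0
        have : (r : ℂ) * z = 1 := by linear_combination -h0
        have := congrArg norm this
        rw [norm_mul, hz, mul_one, Complex.norm_real, Real.norm_of_nonneg hr0, norm_one] at this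
        linarith)
      linarith
    rw [Complex.im_ofReal_mul, Complex.re_ofReal_mul, abs_le]
    exact ⟨⟨by nlinarith, by nlinarith⟩, by nlinarith⟩

/-- Orthogonality of the characters of `ℤ/L`, restricted to exponents below `L`. -/
lemma sum_pow_mul_conj_pow {L : ℕ} {ω : ℂ} (hω : IsPrimitiveRoot ω L) (hω1 : ‖ω‖ = 1) {a b : ℕ}
    (ha : a < L) (hb : b < L) :
    ∑ k ∈ Finset.range L, (ω ^ k) ^ a * star ((ω ^ k) ^ b) = if a = b then (L : ℂ) else 0 := by
  have hstar : ω * star ω = 1 := by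
    rw [Complex.star_def, Complex.mul_conj, Complex.normSq_eq_norm_sq, hω1]; simp
  have h1 : ∀ k, (ω ^ k) ^ a * star ((ω ^ k) ^ b) = (ω ^ a * star ω ^ b) ^ k := fun k => by
    rw [star_pow, star_pow, mul_pow, pow_right_comm, pow_right_comm (star ω)]
  simp only [h1]
  split_ifs with hab
  · subst hab
    simp only [← mul_pow, hstar, one_pow]
    simp
  · have hne : ω ^ a * star ω ^ b ≠ 1 := by
      intro h
      apply hab
      apply hω.pow_inj ha hb
      calc ω ^ a = ω ^ a * (ω * star ω) ^ b := by rw [hstar, one_pow, mul_one]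
        _ = ω ^ a * star ω ^ b * ω ^ b := by rw [mul_pow]; ring
        _ = ω ^ b := by rw [h, one_mul]
    have hpow : (ω ^ a * star ω ^ b) ^ L = 1 := by
      rw [mul_pow, pow_right_comm, pow_right_comm (star ω), ← star_pow, hω.pow_eq_one]
      simp
    have := mul_geom_sum (ω ^ a * star ω ^ b) L
    rw [hpow, sub_self] at this
    exact (mul_eq_zero.1 this).resolve_left (sub_ne_zero.2 hne)

/-- A strictly upper triangular matrix is nilpotent. -/
lemma isNilpotent_of_strictlyUpperTriangular {m : ℕ} (T : Matrix (Fin m) (Fin m) ℂ)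
    (hT : ∀ i j, j ≤ i → T i j = 0) : IsNilpotent T := by
  have h := Matrix.charpoly_of_isUpperTriangular T (fun i j hij => hT i j hij.le)
  simp only [hT _ _ le_rfl, map_zero, sub_zero, Finset.prod_const] at h
  have h2 := Matrix.aeval_self_charpoly T
  rw [h] at h2
  exact ⟨_, by simpa using h2⟩

/-- Nilpotent matrices whose imaginary part is small, whose real part is almost positive, and whose
real part is nevertheless large (the vector `(1, …, 1)` exceeds the bound `m`). They are the
Toeplitz matrices with the symbol of `exists_thin_polynomial`, written as `X diag(f(ωᵏ)) X⋆`
with a coisometry `X` whose columns are normalized characters, so that bounds on the symbol `f` on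
the unit circle pass to the matrix. -/
lemma exists_isNilpotent_toeplitz {ε : ℝ} (hε : 0 < ε) :
    ∃ (m : ℕ) (T H : Matrix (Fin m) (Fin m) ℂ), IsNilpotent T ∧ H.IsHermitian ∧ ‖T - H‖ ≤ ε ∧
      (H + (ε : ℂ) • 1).PosSemidef ∧ (m : ℝ) < (∑ a, ∑ b, H a b).re := by
  obtain ⟨n, c, hc0, hc, hsum, hf⟩ := exists_thin_polynomial hε
  -- With `m = 2 n` rows, at least half of them contain all the coefficients of the symbol.
  obtain ⟨m, hm⟩ : ∃ m, m = 2 * n := ⟨_, rfl⟩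
  -- `L` exceeds all exponents `a + j` with `a < m`, `j < n`, so nothing wraps around modulo `L`.
  obtain ⟨L, hL⟩ : ∃ L, L = m + n + 1 := ⟨_, rfl⟩
  have hL0 : L ≠ 0 := by omega
  have hLC : (L : ℂ) ≠ 0 := by exact_mod_cast hL0
  obtain ⟨ω, hω⟩ : ∃ ω : ℂ, IsPrimitiveRoot ω L := ⟨_, Complex.isPrimitiveRoot_exp L hL0⟩
  have hω1 : ‖ω‖ = 1 := hω.norm'_eq_one hL0
  obtain ⟨s, hs⟩ : ∃ s : ℂ, s = ((Real.sqrt L)⁻¹ : ℝ) := ⟨_, rfl⟩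
  have hss : s * star s * L = 1 := by
    rw [hs, Complex.star_def, Complex.conj_ofReal, ← Complex.ofReal_mul, ← mul_inv,
      Real.mul_self_sqrt (Nat.cast_nonneg L)]
    push_cast
    exact inv_mul_cancel₀ hLC
  let X : Matrix (Fin m) (Fin L) ℂ := fun a k => s * (ω ^ (k : ℕ)) ^ (a : ℕ)
  have hXX : ∀ (g : ℂ → ℂ) a b,
      (X * Matrix.diagonal (fun k : Fin L => g (ω ^ (k : ℕ))) * Xᴴ) a b =
      s * star s *
        ∑ k ∈ Finset.range L, g (ω ^ k) * ((ω ^ k) ^ (a : ℕ) * star ((ω ^ k) ^ (b : ℕ))) := by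
    intro g a b
    rw [Matrix.mul_apply, Finset.sum_range, Finset.mul_sum]
    refine Finset.sum_congr rfl fun k _ => ?_
    rw [Matrix.mul_diagonal, Matrix.conjTranspose_apply, star_mul']
    ring
  have hX1 : X * Xᴴ = 1 := by
    ext a b
    have := hXX (fun _ => 1) a b
    simp only [one_mul] at this
    rw [show (Matrix.diagonal fun _ : Fin L => (1 : ℂ)) = 1 from rfl, Matrix.mul_one,
      sum_pow_mul_conj_pow hω hω1 (by omega) (by omega)] at this
    rw [this, Matrix.one_apply]
    simp only [Fin.ext_iff]
    split_ifs
    · exact hss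
    · simp
  have hXnorm : ‖X‖ ≤ 1 := by
    have h := Matrix.l2_opNorm_conjTranspose_mul_self Xᴴ
    rw [Matrix.conjTranspose_conjTranspose, hX1, Matrix.l2_opNorm_conjTranspose] at h
    have h1 : ‖(1 : Matrix (Fin m) (Fin m) ℂ)‖ ≤ 1 := by
      rw [← Matrix.diagonal_one, Matrix.l2_opNorm_diagonal, pi_norm_le_iff_of_nonneg zero_le_one]
      simp
    nlinarith [norm_nonneg X]
  let f : ℂ → ℂ := fun z => ∑ j ∈ Finset.range n, (c j : ℂ) * z ^ j
  have hnorm : ∀ k : ℕ, ‖ω ^ k‖ = 1 := fun k => by rw [norm_pow, hω1, one_pow]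
  let D : (ℂ → ℂ) → Matrix (Fin L) (Fin L) ℂ := fun g => Matrix.diagonal fun k => g (ω ^ (k : ℕ))
  have hT : ∀ a b, (X * D f * Xᴴ) a b =
      ∑ j ∈ Finset.range n, if (a : ℕ) + j = b then (c j : ℂ) else 0 := by
    intro a b
    rw [hXX f a b]
    simp only [f, Finset.sum_mul]
    rw [Finset.sum_comm, Finset.mul_sum]
    refine Finset.sum_congr rfl fun j hj => ?_
    have := sum_pow_mul_conj_pow hω hω1 (a := a + j) (b := b)
      (by have := Finset.mem_range.1 hj; omega) (by omega)
    calc s * star s * ∑ k ∈ Finset.range L,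
          c j * (ω ^ k) ^ j * ((ω ^ k) ^ (a : ℕ) * star ((ω ^ k) ^ (b : ℕ)))
        = s * star s * c j * ∑ k ∈ Finset.range L,
          (ω ^ k) ^ ((a : ℕ) + j) * star ((ω ^ k) ^ (b : ℕ)) := by
          rw [mul_assoc _ (c j : ℂ), Finset.mul_sum (a := (c j : ℂ)) (s := Finset.range L)]
          congr 1
          refine Finset.sum_congr rfl fun k _ => ?_
          rw [pow_add]
          ring
      _ = _ := by
          rw [this]
          split_ifs
          · linear_combination (c j : ℂ) * hss
          · simp
  have hre : X * D (fun z => ((f z).re : ℂ)) * Xᴴ =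
      (1 / 2 : ℂ) • (X * D f * Xᴴ + (X * D f * Xᴴ)ᴴ) := by
    rw [Matrix.conjTranspose_mul, Matrix.conjTranspose_mul, Matrix.conjTranspose_conjTranspose,
      ← Matrix.mul_assoc, ← Matrix.add_mul, ← Matrix.mul_add, ← Matrix.smul_mul, ← Matrix.mul_smul]
    congr 2
    simp only [D, Matrix.diagonal_conjTranspose, Matrix.diagonal_add, ← Matrix.diagonal_smul]
    congr 1
    ext k
    simp only [Pi.smul_apply, Pi.star_apply, smul_eq_mul, Complex.star_def, Complex.add_conj]
    push_cast
    ring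
  refine ⟨m, X * D f * Xᴴ, X * D (fun z => ((f z).re : ℂ)) * Xᴴ, ?_, ?_, ?_, ?_, ?_⟩
  · refine isNilpotent_of_strictlyUpperTriangular _ fun a b hba => ?_
    rw [hT]
    refine Finset.sum_eq_zero fun j _ => ?_
    split_ifs with h
    · have : j = 0 := by have : (b : ℕ) ≤ a := hba; omega
      rw [this, hc0, Complex.ofReal_zero]
    · rfl
  · refine Matrix.isHermitian_mul_mul_conjTranspose _ ?_
    exact Matrix.isHermitian_diagonal_of_self_adjoint _ (by ext k; simp)
  · rw [← Matrix.sub_mul, ← Matrix.mul_sub]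
    have hD : ‖D f - D (fun z => ((f z).re : ℂ))‖ ≤ ε := by
      simp only [D, Matrix.diagonal_sub]
      rw [Matrix.l2_opNorm_diagonal, pi_norm_le_iff_of_nonneg hε.le]
      intro k
      have h1 : f (ω ^ (k : ℕ)) - ((f (ω ^ (k : ℕ))).re : ℂ) =
          (f (ω ^ (k : ℕ))).im * Complex.I := by
        rw [sub_eq_iff_eq_add']; exact (Complex.re_add_im _).symm
      rw [h1, norm_mul, Complex.norm_I, mul_one, Complex.norm_real]
      exact (hf _ (hnorm k)).1
    calc _ ≤ ‖X‖ * ‖D f - D (fun z => ((f z).re : ℂ))‖ * ‖Xᴴ‖ :=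
          (Matrix.l2_opNorm_mul _ _).trans
            (mul_le_mul_of_nonneg_right (Matrix.l2_opNorm_mul _ _) (norm_nonneg _))
      _ ≤ 1 * ε * 1 := by
          rw [Matrix.l2_opNorm_conjTranspose]
          gcongr
      _ = ε := by ring
  · have h1 : X * D (fun z => ((f z).re : ℂ)) * Xᴴ + (ε : ℂ) • 1 =
        X * D (fun z => ((f z).re : ℂ) + ε) * Xᴴ := by
      have h2 : D (fun z => ((f z).re : ℂ) + ε) = D (fun z => ((f z).re : ℂ)) + (ε : ℂ) • 1 := by
        simp only [D, ← Matrix.diagonal_one, ← Matrix.diagonal_smul, Matrix.diagonal_add]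
        congr 1
        ext k
        simp
      rw [h2, Matrix.mul_add, Matrix.add_mul, Matrix.mul_smul, Matrix.mul_one, Matrix.smul_mul, hX1]
    rw [h1]
    refine Matrix.PosSemidef.mul_mul_conjTranspose_same ?_ X
    refine Matrix.PosSemidef.diagonal fun k => ?_
    have := (hf _ (hnorm k)).2
    have h3 : (0 : ℝ) ≤ (f (ω ^ (k : ℕ))).re + ε := by simp only [f]; linarith
    simpa using (Complex.zero_le_real.2 h3)
  · have hsumT : (∑ a, ∑ b, (X * D (fun z => ((f z).re : ℂ)) * Xᴴ) a b).re =
        ∑ a ∈ Finset.range m, ∑ b ∈ Finset.range m, ∑ j ∈ Finset.range n,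
          if a + j = b then c j else 0 := by
      rw [hre]
      have h1 : ∀ a b : Fin m, (((1 / 2 : ℂ) • (X * D f * Xᴴ + (X * D f * Xᴴ)ᴴ)) a b).re =
          1 / 2 * ((X * D f * Xᴴ) a b).re + 1 / 2 * ((X * D f * Xᴴ) b a).re := by
        intro a b
        rw [Matrix.smul_apply, Matrix.add_apply, Matrix.conjTranspose_apply, smul_eq_mul,
          show (1 / 2 : ℂ) = ((1 / 2 : ℝ) : ℂ) by push_cast; rfl, Complex.re_ofReal_mul,
          Complex.add_re, Complex.star_def, Complex.conj_re, mul_add]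
      simp only [Complex.re_sum, h1, Finset.sum_add_distrib]
      rw [Finset.sum_comm (f := fun a b => 1 / 2 * ((X * D f * Xᴴ) b a).re)]
      simp only [← Finset.mul_sum]
      rw [← add_mul, add_halves, one_mul, Finset.sum_range]
      refine Finset.sum_congr rfl fun a _ => ?_
      rw [Finset.sum_range]
      refine Finset.sum_congr rfl fun b _ => ?_
      rw [hT, Complex.re_sum]
      refine Finset.sum_congr rfl fun j _ => ?_
      split_ifs <;> simp
    have hn0 : (0 : ℝ) < n := by
      rcases Nat.eq_zero_or_pos n with h | h
      · rw [h] at hsum; norm_num at hsum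
      · exact_mod_cast h
    rw [hsumT]
    calc (m : ℝ) = n * 2 := by rw [hm]; push_cast; ring
      _ < n * ∑ j ∈ Finset.range n, c j := mul_lt_mul_of_pos_left hsum hn0
      _ = ∑ a ∈ Finset.range n, ∑ b ∈ Finset.range m, ∑ j ∈ Finset.range n,
          if a + j = b then c j else 0 := by
          rw [← nsmul_eq_mul, ← Finset.card_range n, ← Finset.sum_const, Finset.card_range]
          refine Finset.sum_congr rfl fun a ha => ?_
          rw [Finset.sum_comm]
          refine Finset.sum_congr rfl fun j hj => ?_
          rw [Finset.sum_ite_eq, if_pos]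
          have := Finset.mem_range.1 ha
          have := Finset.mem_range.1 hj
          exact Finset.mem_range.2 (by omega)
      _ ≤ _ := by
          refine Finset.sum_le_sum_of_subset_of_nonneg
            (Finset.range_subset_range.2 (by omega)) fun a _ _ => ?_
          refine Finset.sum_nonneg fun b _ => Finset.sum_nonneg fun j _ => ?_
          split_ifs
          · exact hc j
          · exact le_rfl

/-- A positive diagonal matrix whose largest entry is `1`, attained at a distinguished index, and
which is close to a nilpotent matrix: diagonalize the real part of a Toeplitz matrix, discard its
small negative eigenvalues and normalize. -/
lemma exists_diagonal_near_isNilpotent {ε : ℝ} (hε : 0 < ε) :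
    ∃ (m : ℕ) (d : Fin m → ℝ) (i₀ : Fin m) (N : Matrix (Fin m) (Fin m) ℂ),
      d i₀ = 1 ∧ (∀ i, 0 ≤ d i) ∧ (∀ i, d i ≤ 1) ∧ IsNilpotent N ∧
      ‖Matrix.diagonal (fun i => (d i : ℂ)) - N‖ ≤ ε := by
  obtain ⟨m, T, H, hT, hH, hTH, hpos, hsum⟩ := exists_isNilpotent_toeplitz (half_pos hε)
  have hspec : ∀ i, hH.eigenvalues i ∈ spectrum ℝ H := fun i => hH.eigenvalues_mem_spectrum_real i
  have hlow : ∀ i, -(ε / 2) ≤ hH.eigenvalues i := by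
    intro i
    have h1 : hH.eigenvalues i + ε / 2 ∈ spectrum ℝ (H + ((ε / 2 : ℝ) : ℂ) • 1) := by
      have : ((ε / 2 : ℝ) : ℂ) • (1 : Matrix (Fin m) (Fin m) ℂ) = algebraMap ℝ _ (ε / 2) := by
        rw [Algebra.algebraMap_eq_smul_one]; rfl
      rw [this, add_comm H, spectrum.add_mem_add_iff]
      exact hspec i
    rw [hpos.1.spectrum_real_eq_range_eigenvalues] at h1
    obtain ⟨j, hj⟩ := h1
    have := hpos.eigenvalues_nonneg j
    linarith
  -- Otherwise `1 - H` would be positive, against the value of `H` at the vector `(1, …, 1)`.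
  obtain ⟨i, hi⟩ : ∃ i, 1 < hH.eigenvalues i := by
    by_contra! hcon
    have hherm : (1 - H).IsHermitian := Matrix.isHermitian_one.sub hH
    have hps : (1 - H).PosSemidef := by
      rw [hherm.posSemidef_iff_eigenvalues_nonneg]
      intro i
      have h1 := hherm.eigenvalues_mem_spectrum_real i
      have h1' : hherm.eigenvalues i ∈
          spectrum ℝ (algebraMap ℝ (Matrix (Fin m) (Fin m) ℂ) 1 - H) := by
        rwa [map_one]
      rw [← spectrum.singleton_sub_eq, hH.spectrum_real_eq_range_eigenvalues] at h1'
      obtain ⟨_, rfl, _, ⟨j, rfl⟩, hj⟩ := h1'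
      have := hcon j
      simp only [Pi.zero_apply]
      simp only at hj
      linarith
    have h2 := hps.dotProduct_mulVec_nonneg (fun _ => 1)
    have h3 : star (fun _ => 1 : Fin m → ℂ) ⬝ᵥ (1 - H).mulVec (fun _ => 1) =
        m - ∑ a, ∑ b, H a b := by
      simp [dotProduct, Matrix.mulVec, Matrix.one_apply]
    rw [h3] at h2
    have h4 := (Complex.le_def.1 h2).1
    simp only [Complex.zero_re, Complex.sub_re, Complex.natCast_re] at h4
    linarith
  have : Nonempty (Fin m) := ⟨i⟩
  obtain ⟨i₀, hi₀⟩ := Finite.exists_max hH.eigenvalues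
  obtain ⟨μ, hμ⟩ : ∃ μ, μ = hH.eigenvalues i₀ := ⟨_, rfl⟩
  have hμ1 : 1 < μ := hμ ▸ hi.trans_le (hi₀ i)
  have hμ0 : 0 < μ := by linarith
  let U : Matrix (Fin m) (Fin m) ℂ := hH.eigenvectorUnitary
  have hU1 : star U * U = 1 := Unitary.coe_star_mul_self hH.eigenvectorUnitary
  have hU2 : U * star U = 1 := Unitary.coe_mul_star_self hH.eigenvectorUnitary
  have hdiag : star U * H * U = Matrix.diagonal (fun i => (hH.eigenvalues i : ℂ)) := by
    have := hH.conjStarAlgAut_star_eigenvectorUnitary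
    rwa [Unitary.conjStarAlgAut_star_apply] at this
  have hUn : ‖U‖ ≤ 1 := by
    have : Nontrivial (Matrix (Fin m) (Fin m) ℂ) := inferInstance
    exact (CStarRing.norm_of_mem_unitary hH.eigenvectorUnitary.2).le
  have hmax : ∀ i, max (hH.eigenvalues i) 0 ≤ μ := fun i => max_le (hμ ▸ hi₀ i) hμ0.le
  refine ⟨m, fun i => max (hH.eigenvalues i) 0 / μ, i₀, ((μ⁻¹ : ℝ) : ℂ) • (star U * T * U),
    ?_, fun i => by positivity, fun i => (div_le_one hμ0).2 (hmax i), ?_, ?_⟩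
  · beta_reduce
    rw [← hμ, max_eq_left hμ0.le, div_self hμ0.ne']
  · obtain ⟨n, hn⟩ := hT
    refine ⟨n, ?_⟩
    have hpow : ∀ n, (star U * T * U) ^ n = star U * T ^ n * U := by
      intro n
      induction n with
      | zero => simp [hU1]
      | succ n ih =>
        calc (star U * T * U) ^ (n + 1) = star U * T ^ n * (U * star U) * T * U := by
              rw [pow_succ, ih]; noncomm_ring
          _ = _ := by rw [hU2, mul_one, pow_succ]; noncomm_ring
    rw [smul_pow, hpow, hn, mul_zero, zero_mul, smul_zero]
  · have hsplit : Matrix.diagonal (fun i => ((max (hH.eigenvalues i) 0 / μ : ℝ) : ℂ)) -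
        ((μ⁻¹ : ℝ) : ℂ) • (star U * T * U) =
        ((μ⁻¹ : ℝ) : ℂ) • (Matrix.diagonal
          (fun i => ((max (hH.eigenvalues i) 0 - hH.eigenvalues i : ℝ) : ℂ)) -
          star U * (T - H) * U) := by
      rw [mul_sub, sub_mul, hdiag, smul_sub, smul_sub, ← Matrix.diagonal_smul,
        ← Matrix.diagonal_smul, sub_sub_eq_add_sub, Matrix.diagonal_add]
      congr 2
      ext i
      simp only [Pi.smul_apply, smul_eq_mul]
      push_cast
      ring
    rw [hsplit, norm_smul, Complex.norm_real, Real.norm_of_nonneg (inv_nonneg.2 hμ0.le)]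
    have h1 : ‖(Matrix.diagonal
        (fun i => ((max (hH.eigenvalues i) 0 - hH.eigenvalues i : ℝ) : ℂ)) :
          Matrix (Fin m) (Fin m) ℂ)‖ ≤ ε / 2 := by
      rw [Matrix.l2_opNorm_diagonal, pi_norm_le_iff_of_nonneg (by positivity)]
      intro i
      rw [Complex.norm_real, Real.norm_of_nonneg (by simp)]
      have := hlow i
      rw [sub_le_iff_le_add]
      exact max_le (by linarith) (by linarith)
    have h2 : ‖star U * (T - H) * U‖ ≤ ε / 2 := by
      calc _ ≤ ‖star U‖ * ‖T - H‖ * ‖U‖ :=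
            (norm_mul_le _ _).trans (mul_le_mul_of_nonneg_right (norm_mul_le _ _) (norm_nonneg _))
        _ ≤ 1 * (ε / 2) * 1 := by
            rw [norm_star]
            gcongr
        _ = ε / 2 := by ring
    calc _ ≤ 1 * (ε / 2 + ε / 2) := by
          refine mul_le_mul (inv_le_one_of_one_le₀ hμ1.le)
            ((norm_sub_le _ _).trans (add_le_add h1 h2))
            (norm_nonneg _) zero_le_one
      _ = ε := by ring

end NilpotentMatrix

/-! ### Nilpotents near self-adjoint elements with finite spectrum -/

section Ladder

open scoped Matrix Matrix.Norms.L2Operator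

/-- A discrete version of `exists_diagonal_near_isNilpotent`: the diagonal entries are multiples of
`h`, and the largest one, `(n + 1) h`, occurs only once. -/
lemma exists_ladder_matrix {h δ : ℝ} (hh : 0 ≤ h) (hδ : 0 < δ) (n : ℕ) :
    ∃ (m : ℕ) (k : Fin m → ℕ) (i₀ : Fin m) (N : Matrix (Fin m) (Fin m) ℂ),
      k i₀ = n + 1 ∧ (∀ i, i ≠ i₀ → k i ≤ n) ∧ IsNilpotent N ∧
      ‖Matrix.diagonal (fun i => ((k i * h : ℝ) : ℂ)) - N‖ ≤ h + δ := by
  have hpos : 0 < (n + 1) * h + 1 := by positivity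
  obtain ⟨m, d, i₀, N, hd₀, hd, hd1, hN, hdN⟩ := exists_diagonal_near_isNilpotent
    (div_pos hδ hpos)
  -- Rounding down, and capping at `n`, moves `(n + 1) d i ≤ n + 1` by at most `1`.
  obtain ⟨k, hk⟩ : ∃ k : Fin m → ℕ, k = fun i => if i = i₀ then n + 1 else min n ⌊(n + 1) * d i⌋₊ :=
    ⟨_, rfl⟩
  have hk₀ : k i₀ = n + 1 := by simp [hk]
  have hki : ∀ i, i ≠ i₀ → k i = min n ⌊(n + 1) * d i⌋₊ := fun i hi => by simp [hk, hi]
  have hround : ∀ i, |(k i : ℝ) - (n + 1) * d i| ≤ 1 := by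
    intro i
    by_cases hi : i = i₀
    · rw [hi, hk₀, hd₀]; simp
    · rw [hki i hi, abs_le]
      have h0 : 0 ≤ (n + 1) * d i := mul_nonneg (by positivity) (hd i)
      have h1 := Nat.floor_le h0
      have h2 := Nat.lt_floor_add_one ((n + 1) * d i)
      have h3 : (n + 1) * d i ≤ n + 1 := mul_le_of_le_one_right (by positivity) (hd1 i)
      rw [Nat.cast_min]
      refine ⟨?_, ?_⟩
      · rw [neg_le_sub_iff_le_add, ← sub_le_iff_le_add]
        exact le_min (by linarith) (by linarith)
      · linarith [min_le_right (n : ℝ) ⌊(n + 1) * d i⌋₊]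
  refine ⟨m, k, i₀, (((n + 1) * h : ℝ) : ℂ) • N, hk₀,
    fun i hi => by rw [hki i hi]; exact min_le_left _ _, hN.smul _, ?_⟩
  have hsplit : Matrix.diagonal (fun i => ((k i * h : ℝ) : ℂ)) - (((n + 1) * h : ℝ) : ℂ) • N =
      Matrix.diagonal (fun i => ((((k i : ℝ) - (n + 1) * d i) * h : ℝ) : ℂ)) +
        (((n + 1) * h : ℝ) : ℂ) • (Matrix.diagonal (fun i => (d i : ℂ)) - N) := by
    rw [smul_sub, ← Matrix.diagonal_smul, ← add_sub_assoc, Matrix.diagonal_add]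
    congr 2
    ext i
    simp only [Pi.smul_apply, smul_eq_mul]
    push_cast
    ring
  rw [hsplit]
  refine (norm_add_le _ _).trans (add_le_add ?_ ?_)
  · rw [Matrix.l2_opNorm_diagonal, pi_norm_le_iff_of_nonneg hh]
    intro i
    rw [Complex.norm_real, norm_mul, Real.norm_of_nonneg hh, Real.norm_eq_abs]
    exact mul_le_of_le_one_left hh (hround i)
  · rw [norm_smul, Complex.norm_real, Real.norm_of_nonneg (by positivity)]
    calc (n + 1) * h * _ ≤ ((n + 1) * h + 1) * (δ / ((n + 1) * h + 1)) :=
          mul_le_mul (by linarith) hdN (norm_nonneg _) hpos.le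
      _ = δ := mul_div_cancel₀ _ hpos.ne'

variable {A : Type*} [CStarAlgebra A]

/-- The `⋆`-homomorphism from matrices determined by partial isometries `wᵢ` with common initial
projection `q` and orthogonal ranges: it sends the matrix units to `wᵢ wⱼ⋆`. -/
def matrixEmbedding {m : ℕ} (w : Fin m → A) (q : A)
    (hw : ∀ i j, star (w i) * w j = if i = j then q else 0) (hwq : ∀ i, w i * q = w i) :
    Matrix (Fin m) (Fin m) ℂ →⋆ₙₐ[ℂ] A where
  toFun M := ∑ i, ∑ j, M i j • (w i * star (w j))
  map_smul' c M := by simp [Finset.smul_sum, smul_smul]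
  map_zero' := by simp
  map_add' M N := by simp [add_smul, Finset.sum_add_distrib]
  map_mul' M N := by
    have h1 : ∀ i j k l, (w i * star (w j)) * (w k * star (w l)) =
        if j = k then w i * star (w l) else 0 := by
      intro i j k l
      rw [mul_assoc, ← mul_assoc (star (w j)), hw]
      split_ifs
      · rw [← mul_assoc, hwq]
      · simp
    symm
    calc (∑ i, ∑ j, M i j • (w i * star (w j))) * ∑ k, ∑ l, N k l • (w k * star (w l))
        = ∑ i, ∑ j, ∑ k, ∑ l, if j = k then (M i j * N k l) • (w i * star (w l)) else 0 := by
          rw [Finset.sum_mul]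
          refine Finset.sum_congr rfl fun i _ => ?_
          rw [Finset.sum_mul]
          refine Finset.sum_congr rfl fun j _ => ?_
          rw [Finset.mul_sum]
          refine Finset.sum_congr rfl fun k _ => ?_
          rw [Finset.mul_sum]
          refine Finset.sum_congr rfl fun l _ => ?_
          rw [smul_mul_smul_comm, h1, smul_ite, smul_zero]
      _ = ∑ i, ∑ j, ∑ l, (M i j * N j l) • (w i * star (w l)) := by
          refine Finset.sum_congr rfl fun i _ => Finset.sum_congr rfl fun j _ => ?_
          rw [Finset.sum_comm]
          simp
      _ = ∑ i, ∑ l, (M * N) i l • (w i * star (w l)) := by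
          refine Finset.sum_congr rfl fun i _ => ?_
          rw [Finset.sum_comm]
          simp only [Matrix.mul_apply, Finset.sum_smul]
  map_star' M := by
    simp only [star_sum, star_smul, star_mul, star_star, Matrix.star_apply]
    exact Finset.sum_comm

lemma matrixEmbedding_diagonal {m : ℕ} (w : Fin m → A) (q : A)
    (hw : ∀ i j, star (w i) * w j = if i = j then q else 0) (hwq : ∀ i, w i * q = w i)
    (d : Fin m → ℂ) :
    matrixEmbedding w q hw hwq (Matrix.diagonal d) = ∑ i, d i • (w i * star (w i)) := by
  change ∑ i, ∑ j, Matrix.diagonal d i j • (w i * star (w j)) = _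
  simp [Matrix.diagonal_apply]

lemma norm_add_eq_max_of_orthogonal {x y : A} (h : star x * y = 0) (h' : x * star y = 0) :
    ‖x + y‖ = max ‖x‖ ‖y‖ := by
  have h₂ : star y * x = 0 := by simpa using congrArg star h
  have hxy : star (x + y) * (x + y) = star x * x + star y * y := by
    rw [star_add, add_mul, mul_add, mul_add, h, h₂, add_zero, zero_add]
  have hmax := (IsSelfAdjoint.star_mul_self x).norm_add_eq_max (IsSelfAdjoint.star_mul_self y)
    (by rw [mul_assoc, ← mul_assoc x, h', zero_mul, mul_zero])
  rw [← hxy, CStarRing.norm_star_mul_self, CStarRing.norm_star_mul_self,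
    CStarRing.norm_star_mul_self] at hmax
  refine (mul_self_inj (norm_nonneg _) (le_max_of_le_left (norm_nonneg _))).1 (hmax.trans ?_)
  rcases le_total ‖x‖ ‖y‖ with hle | hle
  · rw [max_eq_right hle, max_eq_right (mul_self_le_mul_self (norm_nonneg _) hle)]
  · rw [max_eq_left hle, max_eq_left (mul_self_le_mul_self (norm_nonneg _) hle)]

lemma IsStarProjection.sum_of_orthogonal {ι R : Type*} [NonUnitalRing R] [StarRing R]
    (s : Finset ι) (P : ι → R) (hP : ∀ i ∈ s, IsStarProjection (P i))
    (hPP : ∀ i ∈ s, ∀ j ∈ s, i ≠ j → P i * P j = 0) :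
    IsStarProjection (∑ i ∈ s, P i) := by
  refine ⟨?_, ?_⟩
  · rw [IsIdempotentElem, Finset.sum_mul_sum]
    refine Finset.sum_congr rfl fun i hi => ?_
    rw [Finset.sum_eq_single_of_mem i hi fun j hj hji => hPP i hi j hj hji.symm]
    exact (hP i hi).isIdempotentElem.eq
  · exact isSelfAdjoint_sum _ fun i hi => (hP i hi).isSelfAdjoint

variable [PartialOrder A] [StarOrderedRing A]

/-- Self-adjoint elements `∑ k h Pₖ` with finite spectrum in `h ℕ`, all whose levels below the top
are occupied, are within `h + δ` of a nilpotent. By induction on the top level: copies of the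
top projection `Q = P (n + 1)`, found below the lower `P k`, carry a matrix algebra in which
`exists_ladder_matrix` provides a nilpotent; splitting it off empties the top level and leaves the
lower ones nonzero. -/
lemma exists_isNilpotent_near_sum (hs : IsSimpleCStarAlgebra A) (hpi : IsPurelyInfinite A)
    {h δ : ℝ} (hh : 0 ≤ h) (hδ : 0 < δ) (n : ℕ) : ∀ P : ℕ → A,
    (∀ k ≤ n, IsStarProjection (P k)) → (∀ j ≤ n, ∀ k ≤ n, j ≠ k → P j * P k = 0) →
    (∀ k < n, P k ≠ 0) →
    ∃ N : A, IsNilpotent N ∧ (∑ k ∈ Finset.range (n + 1), P k) * N = N ∧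
      N * (∑ k ∈ Finset.range (n + 1), P k) = N ∧
      ‖∑ k ∈ Finset.range (n + 1), ((k * h : ℝ) : ℂ) • P k - N‖ ≤ h + δ := by
  induction n with
  | zero => intro P _ _ _; exact ⟨0, IsNilpotent.zero, by simp, by simp, by simp; positivity⟩
  | succ n ih =>
    intro P hP hPP hP0
    have hex : ∀ k, ∃ u : ℕ → A, k ≤ n →
        (∀ i j, star (u i) * u j = if i = j then 1 else 0) ∧ ∀ i, P k * u i = u i := by
      intro k
      by_cases hk : k ≤ n
      · obtain ⟨u, hu⟩ := exists_orthogonal_isometries_under hs hpi (hP k (by omega))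
          (hP0 k (by omega))
        exact ⟨u, fun _ => hu⟩
      · exact ⟨0, fun h => absurd h hk⟩
    choose u hu using hex
    obtain ⟨m, k, i₀, M, hk₀, hk, hM, hMn⟩ := exists_ladder_matrix hh hδ n
    have hkn : ∀ i, k i ≤ n + 1 := fun i => by
      by_cases hi : i = i₀
      · rw [hi, hk₀]
      · exact (hk i hi).trans (Nat.le_succ n)
    obtain ⟨Q, hQ⟩ : ∃ Q, Q = P (n + 1) := ⟨_, rfl⟩
    have hQp : IsStarProjection Q := hQ ▸ hP _ le_rfl
    -- The index `0` of the isometries is left unused, which keeps the remainders nonzero.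
    obtain ⟨w, hw⟩ : ∃ w : Fin m → A, w = fun i => if i = i₀ then Q else u (k i) (i + 1) * Q :=
      ⟨_, rfl⟩
    have hw₀ : w i₀ = Q := by simp [hw]
    have hwi : ∀ i, i ≠ i₀ → w i = u (k i) (i + 1) * Q := fun i hi => by simp [hw, hi]
    have hwQ : ∀ i, w i * Q = w i := by
      intro i
      by_cases hi : i = i₀
      · rw [hi, hw₀, hQp.isIdempotentElem.eq]
      · rw [hwi i hi, mul_assoc, hQp.isIdempotentElem.eq]
    have hPw : ∀ i, P (k i) * w i = w i := by
      intro i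
      by_cases hi : i = i₀
      · rw [hi, hk₀, hw₀, ← hQ, hQp.isIdempotentElem.eq]
      · rw [hwi i hi, ← mul_assoc, (hu _ (hk i hi)).2]
    have hPw' : ∀ i, ∀ l ≤ n + 1, l ≠ k i → P l * w i = 0 := by
      intro i l hl hli
      rw [← hPw i, ← mul_assoc, hPP l hl _ (hkn i) hli, zero_mul]
    have hsP : ∀ i, star (w i) * P (k i) = star (w i) := by
      intro i
      simpa [(hP _ (hkn i)).isSelfAdjoint.star_eq] using congrArg star (hPw i)
    have hww : ∀ i j, star (w i) * w j = if i = j then Q else 0 := by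
      intro i j
      by_cases hkij : k i = k j
      · by_cases hi : i = i₀
        · have hj : j = i₀ := by
            by_contra hj
            have := hk j hj
            rw [← hkij, hi, hk₀] at this
            omega
          rw [hi, hj, hw₀, if_pos rfl, hQp.isSelfAdjoint.star_eq, hQp.isIdempotentElem.eq]
        · have hj : j ≠ i₀ := by
            rintro rfl
            have := hk i hi
            omega
          rw [hwi i hi, hwi j hj, ← hkij, star_mul, hQp.isSelfAdjoint.star_eq, mul_assoc,
            ← mul_assoc (star _), (hu _ (hk i hi)).1]
          by_cases hij : i = j
          · rw [if_pos (by rw [hij]), if_pos hij, one_mul, hQp.isIdempotentElem.eq]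
          · rw [if_neg (by simpa [Fin.ext_iff] using hij), if_neg hij, zero_mul, mul_zero]
      · rw [if_neg (fun hij => hkij (by rw [hij])), ← hsP i, mul_assoc,
          hPw' j _ (hkn i) hkij, mul_zero]
    obtain ⟨Φ, hΦ⟩ : ∃ Φ, Φ = matrixEmbedding w Q hww hwQ := ⟨_, rfl⟩
    have hΦd : ∀ d : Fin m → ℂ, Φ (Matrix.diagonal d) = ∑ i, d i • (w i * star (w i)) :=
      fun d => hΦ ▸ matrixEmbedding_diagonal w Q hww hwQ d
    obtain ⟨F, hF⟩ : ∃ F : Fin m → A, F = fun i => w i * star (w i) := ⟨_, rfl⟩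
    have hFp : ∀ i, IsStarProjection (F i) := by
      intro i
      rw [hF]
      refine ⟨?_, IsSelfAdjoint.mul_star_self _⟩
      rw [IsIdempotentElem, mul_assoc, ← mul_assoc (star (w i)), hww, if_pos rfl, ← mul_assoc, hwQ]
    have hFF : ∀ i j, i ≠ j → F i * F j = 0 := by
      intro i j hij
      simp only [hF]
      rw [mul_assoc, ← mul_assoc (star (w i)), hww, if_neg hij, zero_mul, mul_zero]
    have hPF : ∀ l ≤ n + 1, ∀ i, P l * F i = if k i = l then F i else 0 := by
      intro l hl i
      simp only [hF]
      rw [← mul_assoc]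
      split_ifs with h
      · rw [← h, hPw]
      · rw [hPw' i l hl (Ne.symm h), zero_mul]
    obtain ⟨G, hG⟩ : ∃ G : ℕ → A, G = fun l => ∑ i with k i = l, F i := ⟨_, rfl⟩
    have hGp : ∀ l, IsStarProjection (G l) := fun l => by
      rw [hG]
      exact IsStarProjection.sum_of_orthogonal _ _ (fun i _ => hFp i) fun i _ j _ hij => hFF i j hij
    have hPG : ∀ j ≤ n + 1, ∀ l, P j * G l = if l = j then G l else 0 := by
      intro j hj l
      simp only [hG, Finset.mul_sum, hPF j hj]
      split_ifs with h
      · refine Finset.sum_congr rfl fun i hi => ?_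
        rw [if_pos (by rw [← h]; exact (Finset.mem_filter.1 hi).2)]
      · refine Finset.sum_eq_zero fun i hi => ?_
        rw [if_neg (by rw [(Finset.mem_filter.1 hi).2]; exact h)]
    have hGP : ∀ j ≤ n + 1, ∀ l, G l * P j = if l = j then G l else 0 := by
      intro j hj l
      have := congrArg star (hPG j hj l)
      rw [star_mul, (hGp l).isSelfAdjoint.star_eq, (hP j hj).isSelfAdjoint.star_eq] at this
      rw [this]
      split_ifs
      · exact (hGp l).isSelfAdjoint.star_eq
      · exact star_zero A
    have hFG : ∀ i l, F i * G l = if k i = l then F i else 0 := by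
      intro i l
      simp only [hG, Finset.mul_sum]
      split_ifs with h
      · rw [Finset.sum_eq_single_of_mem i (by simpa using h) fun j _ hj => hFF i j hj.symm,
          (hFp i).isIdempotentElem.eq]
      · refine Finset.sum_eq_zero fun j hj => hFF i j ?_
        rintro rfl
        exact h (Finset.mem_filter.1 hj).2
    have hGG : ∀ j l, j ≠ l → G j * G l = 0 := by
      intro j l hjl
      rw [hG]
      simp only
      rw [Finset.sum_mul]
      refine Finset.sum_eq_zero fun i hi => ?_
      have := hFG i l
      rw [if_neg (by rw [(Finset.mem_filter.1 hi).2]; exact hjl)] at this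
      simpa only [hG] using this
    have hGtop : G (n + 1) = P (n + 1) := by
      have : G (n + 1) = F i₀ := by
        rw [hG]
        refine Finset.sum_eq_single_of_mem i₀ (by simpa using hk₀) fun j hj hj₀ => ?_
        have h1 := (Finset.mem_filter.1 hj).2
        have h2 := hk j hj₀
        omega
      rw [this, hF]
      simp only
      rw [hw₀, hQp.isSelfAdjoint.star_eq, hQp.isIdempotentElem.eq, hQ]
    -- At the top level nothing remains: `P' (n + 1) = 0`.
    obtain ⟨P', hP'⟩ : ∃ P' : ℕ → A, P' = fun l => P l - G l := ⟨_, rfl⟩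
    have hP'p : ∀ l ≤ n + 1, IsStarProjection (P' l) := fun l hl => by
      rw [hP']
      exact (hGp l).sub_of_mul_eq_right (hP l hl) (by rw [hPG l hl, if_pos rfl])
    have hFP : ∀ i, ∀ l ≤ n + 1, F i * P' l = 0 := by
      intro i l hl
      have h1 : F i * P l = if k i = l then F i else 0 := by
        have := congrArg star (hPF l hl i)
        rw [star_mul, (hFp i).isSelfAdjoint.star_eq, (hP l hl).isSelfAdjoint.star_eq] at this
        rw [this]
        split_ifs
        · exact (hFp i).isSelfAdjoint.star_eq
        · exact star_zero A
      simp only [hP']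
      rw [mul_sub, h1, hFG, sub_self]
    have hP'P' : ∀ j ≤ n + 1, ∀ l ≤ n + 1, j ≠ l → P' j * P' l = 0 := by
      intro j hj l hl hjl
      simp only [hP']
      rw [sub_mul, mul_sub, mul_sub, hPP j hj l hl hjl, hPG j hj, hGP l hl, hGG j l hjl,
        if_neg hjl.symm, if_neg hjl]
      simp
    have hP'0 : ∀ l ≤ n, P' l ≠ 0 := by
      intro l hl h0
      have h1 : star (u l 0) * u l 0 = 1 := by rw [(hu l hl).1, if_pos rfl]
      have h2 : G l * u l 0 = 0 := by
        simp only [hG, hF]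
        rw [Finset.sum_mul]
        refine Finset.sum_eq_zero fun i hi => ?_
        have hil := (Finset.mem_filter.1 hi).2
        have hi₀ : i ≠ i₀ := by rintro rfl; omega
        rw [mul_assoc, hwi i hi₀, hil, star_mul, mul_assoc (star Q), (hu l hl).1,
          if_neg (Nat.succ_ne_zero _), mul_zero, mul_zero]
      have h3 : u l 0 = 0 := by
        calc u l 0 = P' l * u l 0 := by
              simp only [hP']
              rw [sub_mul, h2, sub_zero, (hu l hl).2]
          _ = 0 := by rw [h0, zero_mul]
      have := hs.1
      rw [h3, mul_zero] at h1
      exact zero_ne_one h1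
    obtain ⟨N', hN', hEN, hNE, hn'⟩ := ih P' (fun l hl => hP'p l (by omega))
      (fun j hj l hl => hP'P' j (by omega) l (by omega)) (fun l hl => hP'0 l (by omega))
    obtain ⟨E, hE⟩ : ∃ E, E = ∑ l ∈ Finset.range (n + 1), P' l := ⟨_, rfl⟩
    obtain ⟨E₂, hE₂⟩ : ∃ E₂, E₂ = ∑ i, F i := ⟨_, rfl⟩
    rw [← hE] at hEN hNE
    have hEp : IsStarProjection E := hE ▸ IsStarProjection.sum_of_orthogonal _ _
      (fun l hl => hP'p l (Finset.mem_range.1 hl).le) fun j hj l hl hjl =>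
        hP'P' j (Finset.mem_range.1 hj).le l (Finset.mem_range.1 hl).le hjl
    have hE₂p : IsStarProjection E₂ := hE₂ ▸ IsStarProjection.sum_of_orthogonal _ _
      (fun i _ => hFp i) fun i _ j _ hij => hFF i j hij
    have hE₂E : E₂ * E = 0 := by
      rw [hE, hE₂, Finset.sum_mul_sum]
      exact Finset.sum_eq_zero fun i _ => Finset.sum_eq_zero fun l hl =>
        hFP i l (Finset.mem_range.1 hl).le
    have hEE₂ : E * E₂ = 0 := by
      simpa [hEp.isSelfAdjoint.star_eq, hE₂p.isSelfAdjoint.star_eq] using congrArg star hE₂E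
    have hΦ1 : Φ 1 = E₂ := by
      rw [← Matrix.diagonal_one, hΦd, hE₂, hF]
      simp
    have hE₂Φ : ∀ X, E₂ * Φ X = Φ X := fun X => by rw [← hΦ1, ← map_mul, one_mul]
    have hΦE₂ : ∀ X, Φ X * E₂ = Φ X := fun X => by rw [← hΦ1, ← map_mul, mul_one]
    have hEΦ : ∀ X, E * Φ X = 0 := fun X => by rw [← hE₂Φ, ← mul_assoc, hEE₂, zero_mul]
    have hΦE : ∀ X, Φ X * E = 0 := fun X => by rw [← hΦE₂, mul_assoc, hE₂E, mul_zero]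
    have hEN₂ : E₂ * N' = 0 := by rw [← hEN, ← mul_assoc, hE₂E, zero_mul]
    have hNE₂ : N' * E₂ = 0 := by rw [← hNE, mul_assoc, hEE₂, mul_zero]
    -- Regroup sums over the levels of `P` into those of `P'` and of the matrix algebra.
    have hregroup : ∀ c : ℕ → ℂ, ∑ l ∈ Finset.range (n + 1 + 1), c l • P l =
        ∑ l ∈ Finset.range (n + 1), c l • P' l + ∑ i, c (k i) • F i := by
      intro c
      have h1 : ∑ i, c (k i) • F i = ∑ l ∈ Finset.range (n + 1 + 1), c l • G l := by
        rw [← Finset.sum_fiberwise_of_maps_to (g := k) (t := Finset.range (n + 1 + 1))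
          fun i _ => Finset.mem_range.2 (Nat.lt_succ_of_le (hkn i))]
        refine Finset.sum_congr rfl fun l _ => ?_
        simp only [hG, Finset.smul_sum]
        exact Finset.sum_congr rfl fun i hi => by rw [(Finset.mem_filter.1 hi).2]
      rw [h1, Finset.sum_range_succ _ (n + 1), Finset.sum_range_succ _ (n + 1), hGtop, ← add_assoc,
        ← Finset.sum_add_distrib]
      congr 1
      refine Finset.sum_congr rfl fun l _ => ?_
      rw [hP', ← smul_add, sub_add_cancel]
    have hEsum : ∑ l ∈ Finset.range (n + 1 + 1), P l = E + E₂ := by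
      have := hregroup fun _ => 1
      simpa [hE, hE₂] using this
    have hΦM : IsNilpotent (Φ M) := by
      obtain ⟨r, hr⟩ := hM
      have hpow : ∀ r, Φ M ^ (r + 1) = Φ (M ^ (r + 1)) := by
        intro r
        induction r with
        | zero => simp
        | succ r ihr => rw [pow_succ, ihr, ← map_mul, ← pow_succ]
      exact ⟨r + 1, by rw [hpow, pow_succ, hr, zero_mul, map_zero]⟩
    refine ⟨N' + Φ M, ?_, ?_, ?_, ?_⟩
    · refine Commute.isNilpotent_add ?_ hN' hΦM
      rw [Commute, SemiconjBy, ← hE₂Φ M, ← mul_assoc, hNE₂, zero_mul, hE₂Φ, ← hΦE₂ M, mul_assoc,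
        hEN₂, mul_zero]
    · rw [hEsum, add_mul, mul_add, mul_add, hEN, hEΦ, hEN₂, hE₂Φ, add_zero, zero_add]
    · rw [hEsum, add_mul, mul_add, mul_add, hNE, hNE₂, hΦE, hΦE₂, add_zero, zero_add]
    · rw [hregroup fun l => ((l * h : ℝ) : ℂ)]
      have h1 : ∑ i, ((k i * h : ℝ) : ℂ) • F i =
          Φ (Matrix.diagonal fun i => ((k i * h : ℝ) : ℂ)) := by rw [hΦd, hF]
      rw [h1, add_sub_add_comm, ← map_sub]
      have hP'E : ∀ l ∈ Finset.range (n + 1), E * P' l = P' l ∧ P' l * E = P' l := by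
        intro l hl
        have hl' := (Finset.mem_range.1 hl).le
        rw [hE, Finset.sum_mul, Finset.mul_sum, Finset.sum_eq_single_of_mem l hl,
          Finset.sum_eq_single_of_mem l hl]
        · exact ⟨(hP'p l hl').isIdempotentElem.eq, (hP'p l hl').isIdempotentElem.eq⟩
        · exact fun j hj hjl => hP'P' l hl' j (Finset.mem_range.1 hj).le hjl.symm
        · exact fun j hj hjl => hP'P' j (Finset.mem_range.1 hj).le l hl' hjl
      have hx : E * (∑ l ∈ Finset.range (n + 1), ((l * h : ℝ) : ℂ) • P' l - N') =
          ∑ l ∈ Finset.range (n + 1), ((l * h : ℝ) : ℂ) • P' l - N' := by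
        rw [mul_sub, hEN, Finset.mul_sum]
        congr 1
        exact Finset.sum_congr rfl fun l hl => by rw [mul_smul_comm, (hP'E l hl).1]
      have hx' : (∑ l ∈ Finset.range (n + 1), ((l * h : ℝ) : ℂ) • P' l - N') * E =
          ∑ l ∈ Finset.range (n + 1), ((l * h : ℝ) : ℂ) • P' l - N' := by
        rw [sub_mul, hNE, Finset.sum_mul]
        congr 1
        exact Finset.sum_congr rfl fun l hl => by rw [smul_mul_assoc, (hP'E l hl).2]
      rw [norm_add_eq_max_of_orthogonal]
      · exact max_le hn' ((NonUnitalStarAlgHom.norm_apply_le Φ _).trans hMn)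
      · rw [← hx, star_mul, hEp.isSelfAdjoint.star_eq, mul_assoc, hEΦ, mul_zero]
      · rw [← map_star, ← hx', mul_assoc, hEΦ, mul_zero]

end Ladder

/-! ### Spectra of limits of quasinilpotents -/

section Spectrum

variable {A : Type*} [CStarAlgebra A]

/-- An element `y` is invertible once its distance to a unit `x` is small compared with the inverse
`u` of `x`. -/
lemma isUnit_of_norm_sub_mul_lt_one {B : Type*} [NormedRing B] [CompleteSpace B] {x y u : B}
    (hx : IsUnit x) (hux : u * x = 1) (h : ‖u‖ * ‖x - y‖ < 1) : IsUnit y := by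
  have hxu : x * u = 1 := by
    obtain ⟨x, rfl⟩ := hx
    rw [Units.mul_eq_one_iff_eq_inv] at hux
    rw [hux, Units.mul_inv]
  have h1 : y = x * (1 - u * (x - y)) := by
    rw [mul_sub, mul_one, ← mul_assoc, hxu, one_mul, sub_sub_cancel]
  rw [h1]
  exact hx.mul (isUnit_one_sub_of_norm_lt_one ((norm_mul_le _ _).trans_lt h))

/-- No gap of the spectrum of a self-adjoint limit of quasinilpotents can separate a positive
spectral value `s` from `0`. The resolvents of the quasinilpotents are holomorphic inside a circle
that crosses the gap at `t` and surrounds `s`, and they are uniformly bounded on that circle; by the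
maximum principle they are uniformly bounded at `s`, which makes `s - a` invertible. -/
lemma mem_spectrum_of_mem_closure_quasinilpotentElements {a : A} (ha : IsSelfAdjoint a)
    (hcl : a ∈ closure (quasinilpotentElements A)) {s t : ℝ} (ht : 0 < t) (hts : t < s)
    (hs : (s : ℂ) ∈ spectrum ℂ a) : (t : ℂ) ∈ spectrum ℂ a := by
  by_contra htn
  obtain ⟨R, hR⟩ : ∃ R : ℝ, ‖a‖ * ‖(1 : A)‖ + s < R := exists_gt _
  have hRs : s < R := by
    have : 0 ≤ ‖a‖ * ‖(1 : A)‖ := by positivity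
    linarith
  have hRn : (R : ℂ) ∉ spectrum ℂ a := by
    intro h
    have := spectrum.norm_le_norm_mul_of_mem h
    rw [Complex.norm_real, Real.norm_of_nonneg (by linarith)] at this
    linarith
  obtain ⟨c, hc⟩ : ∃ c : ℝ, c = (t + R) / 2 := ⟨_, rfl⟩
  obtain ⟨r, hr⟩ : ∃ r : ℝ, r = (R - t) / 2 := ⟨_, rfl⟩
  have hr0 : 0 < r := by linarith
  have hcirc : ∀ z ∈ Metric.sphere (c : ℂ) r, z ∉ spectrum ℂ a := by
    intro z hz hza
    have him : z.im = 0 := ha.im_eq_zero_of_mem_spectrum hza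
    have hzr : z = (z.re : ℂ) := Complex.ext (by simp) (by simp [him])
    rw [mem_sphere_iff_norm, hzr, ← Complex.ofReal_sub, Complex.norm_real, Real.norm_eq_abs,
      abs_eq hr0.le] at hz
    rcases hz with hz | hz
    · have : z.re = R := by linarith
      rw [hzr, this] at hza
      exact hRn hza
    · have : z.re = t := by linarith
      rw [hzr, this] at hza
      exact htn hza
  have hcont : ContinuousOn (resolvent a) (Metric.sphere (c : ℂ) r) := by
    intro z hz
    exact (spectrum.hasDerivAt_resolvent_const_left
      (not_not.1 (hcirc z hz))).continuousAt.continuousWithinAt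
  obtain ⟨C, hC⟩ := (isCompact_sphere (c : ℂ) r).exists_bound_of_continuousOn hcont
  have hC0 : 0 ≤ C := (norm_nonneg _).trans (hC (c + r) (by simp [hr0.le]))
  obtain ⟨q, hq, hqa⟩ := Metric.mem_closure_iff.1 hcl (1 / (2 * C + 1)) (by positivity)
  rw [dist_comm, dist_eq_norm, lt_div_iff₀ (by positivity)] at hqa
  have hq' : ∀ z : ℂ, z ≠ 0 → IsUnit (algebraMap ℂ A z - q) := by
    intro z hz
    have : z ∉ spectrum ℂ q := by rw [show spectrum ℂ q = {0} from hq]; simpa using hz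
    exact not_not.1 this
  have hball : ∀ z ∈ Metric.closedBall (c : ℂ) r, z ≠ 0 := by
    rintro z hz rfl
    rw [mem_closedBall_iff_norm, zero_sub, norm_neg, Complex.norm_real,
      Real.norm_of_nonneg (by linarith)] at hz
    linarith
  have hbound : ∀ z ∈ Metric.sphere (c : ℂ) r, ‖resolvent q z‖ ≤ 2 * C := by
    intro z hz
    have hqz := hq' z (hball z (Metric.sphere_subset_closedBall hz))
    have haz : IsUnit (algebraMap ℂ A z - a) := not_not.1 (hcirc z hz)
    have hid : resolvent q z = resolvent a z + resolvent q z * (q - a) * resolvent a z := by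
      have h1 : resolvent q z * (algebraMap ℂ A z - q) = 1 := Ring.inverse_mul_cancel _ hqz
      have h2 : (algebraMap ℂ A z - a) * resolvent a z = 1 := Ring.mul_inverse_cancel _ haz
      have h3 : q - a = (algebraMap ℂ A z - a) - (algebraMap ℂ A z - q) := by abel
      rw [h3, mul_sub, sub_mul, h1, mul_assoc, h2, one_mul, mul_one, add_sub_cancel]
    have h4 : ‖resolvent q z‖ ≤ C + ‖resolvent q z‖ * ‖q - a‖ * C := by
      calc ‖resolvent q z‖ ≤ ‖resolvent a z‖ + ‖resolvent q z * (q - a) * resolvent a z‖ := by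
            conv_lhs => rw [hid]
            exact norm_add_le _ _
        _ ≤ C + ‖resolvent q z‖ * ‖q - a‖ * C := by
            refine add_le_add (hC z hz) ((norm_mul_le _ _).trans ?_)
            exact mul_le_mul (norm_mul_le _ _) (hC z hz) (norm_nonneg _) (by positivity)
    have h5 : ‖q - a‖ * C ≤ 1 / 2 := by nlinarith [norm_nonneg (q - a)]
    nlinarith [norm_nonneg (resolvent q z)]
  have hdiff : DiffContOnCl ℂ (resolvent q) (Metric.ball (c : ℂ) r) := by
    refine DifferentiableOn.diffContOnCl fun z hz => ?_
    exact (spectrum.hasDerivAt_resolvent_const_left (hq' z (hball z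
      (Metric.closure_ball_subset_closedBall hz)))).differentiableAt.differentiableWithinAt
  have hsball : (s : ℂ) ∈ closure (Metric.ball (c : ℂ) r) := by
    refine subset_closure ?_
    rw [mem_ball_iff_norm, ← Complex.ofReal_sub, Complex.norm_real, Real.norm_eq_abs, abs_lt]
    constructor <;> linarith
  have hmax : ‖resolvent q (s : ℂ)‖ ≤ 2 * C :=
    Complex.norm_le_of_forall_mem_frontier_norm_le Metric.isBounded_ball hdiff
      (fun z hz => hbound z (Metric.frontier_ball_subset_sphere hz)) hsball
  have hqs := hq' s (by exact_mod_cast (by linarith : s ≠ 0))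
  refine hs (isUnit_of_norm_sub_mul_lt_one hqs (Ring.inverse_mul_cancel _ hqs) ?_)
  rw [sub_sub_sub_cancel_left, norm_sub_rev]
  change ‖resolvent q (s : ℂ)‖ * _ < 1
  nlinarith [norm_nonneg (q - a)]

end Spectrum

/-! ### Spectral rounding -/

section SpectralRounding

variable {A : Type*} [CStarAlgebra A]

/-- The spectrum of a self-adjoint `b` comes within `η` of each spectral value of any element at
distance less than `η`. -/
lemma exists_mem_spectrum_abs_sub_lt {a b : A} (hb : IsSelfAdjoint b) {η t : ℝ}
    (hab : ‖a - b‖ < η) (ht : t ∈ spectrum ℝ a) : ∃ x ∈ spectrum ℝ b, |x - t| < η := by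
  by_contra! hcon
  have hη : 0 < η := (norm_nonneg _).trans_lt hab
  have hne : ∀ x ∈ spectrum ℝ b, t - x ≠ 0 := fun x hx h0 => by
    have := hcon x hx
    rw [← neg_sub, h0, neg_zero, abs_zero] at this
    linarith
  have hcont : ContinuousOn (fun x : ℝ => (t - x)⁻¹) (spectrum ℝ b) :=
    (continuousOn_const.sub continuousOn_id).inv₀ hne
  have htb : t ∉ spectrum ℝ b := fun h => hne t h (sub_self t)
  have hu : cfc (fun x : ℝ => (t - x)⁻¹) b * (algebraMap ℝ A t - b) = 1 := by
    have h1 : algebraMap ℝ A t - b = cfc (fun x : ℝ => t - x) b := by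
      rw [cfc_sub _ _ b, cfc_const t b, cfc_id' ℝ b]
    rw [h1, ← cfc_mul _ (fun x : ℝ => t - x) b hcont (continuousOn_const.sub continuousOn_id),
      ← cfc_const_one ℝ b]
    exact cfc_congr fun x hx => inv_mul_cancel₀ (hne x hx)
  have hnorm : ‖cfc (fun x : ℝ => (t - x)⁻¹) b‖ ≤ η⁻¹ := by
    refine norm_cfc_le (inv_nonneg.2 hη.le) fun x hx => ?_
    rw [norm_inv, Real.norm_eq_abs, abs_sub_comm]
    exact inv_anti₀ hη (hcon x hx)
  refine ht (isUnit_of_norm_sub_mul_lt_one (not_not.1 htb) hu ?_)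
  rw [sub_sub_sub_cancel_left]
  calc _ ≤ η⁻¹ * ‖a - b‖ := mul_le_mul_of_nonneg_right hnorm (norm_nonneg _)
    _ < η⁻¹ * η := mul_lt_mul_of_pos_left hab (inv_pos.2 hη)
    _ = 1 := inv_mul_cancel₀ hη.ne'

/-- The index `k ≤ n` of the multiple `k h` nearest to `x`, encoded as the number of midpoints
`(j + 1/2) h`, `j < n`, to the left of `x`; at a midpoint the lower index is taken. -/
noncomputable def gridLevel (n : ℕ) (h x : ℝ) : ℕ :=
  ∑ j ∈ Finset.range n, if (j + 1 / 2) * h < x then 1 else 0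

lemma continuousOn_gridLevel {n : ℕ} {h : ℝ} {s : Set ℝ}
    (hs : ∀ j < n, ((j : ℝ) + 1 / 2) * h ∉ s) : ContinuousOn (gridLevel n h) s := by
  refine continuousOn_finsetSum _ fun j hj x hx => ContinuousAt.continuousWithinAt ?_
  have hne : ((j : ℝ) + 1 / 2) * h ≠ x := fun he => hs j (Finset.mem_range.1 hj) (he ▸ hx)
  rcases hne.lt_or_gt with hlt | hgt
  · refine continuousAt_const (y := 1) |>.congr ?_
    filter_upwards [eventually_gt_nhds hlt] with y hy
    rw [if_pos hy]
  · refine continuousAt_const (y := 0) |>.congr ?_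
    filter_upwards [eventually_lt_nhds hgt] with y hy
    rw [if_neg hy.le.not_gt]

lemma gridLevel_eq_min {n : ℕ} {h : ℝ} (hh : 0 < h) (x : ℝ) :
    gridLevel n h x = min n ⌈x / h - 1 / 2⌉₊ := by
  rw [gridLevel, ← Finset.card_filter, ← Finset.card_range (min n _)]
  congr 1
  ext j
  rw [Finset.mem_filter, Finset.mem_range, Finset.mem_range, lt_min_iff, Nat.lt_ceil,
    lt_sub_iff_add_lt, lt_div_iff₀ hh]

lemma abs_sub_gridLevel_le {n : ℕ} {h η x : ℝ} (hh : 0 < h) (hη : 0 ≤ η) (hx : -η ≤ x)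
    (hx' : x ≤ n * h + η) : |x - gridLevel n h x * h| ≤ h / 2 + η := by
  rw [gridLevel_eq_min hh]
  obtain ⟨y, hy⟩ : ∃ y, y = x / h - 1 / 2 := ⟨_, rfl⟩
  have hxy : x = y * h + h / 2 := by rw [hy]; field_simp; ring
  rw [← hy, abs_le]
  rcases le_or_gt y 0 with hy0 | hy0
  · rw [Nat.ceil_eq_zero.2 hy0, min_eq_right (Nat.zero_le n), Nat.cast_zero, zero_mul, sub_zero]
    constructor <;> nlinarith
  · rcases le_or_gt ⌈y⌉₊ n with hn | hn
    · rw [min_eq_right hn]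
      have h1 := Nat.le_ceil y
      have h2 := Nat.ceil_lt_add_one hy0.le
      constructor <;> nlinarith
    · rw [min_eq_left hn.le]
      have h1 := Nat.lt_ceil.1 hn
      constructor <;> nlinarith

/-- The spectral projection of `b` for the level set `{f = k}` of an `ℕ`-valued function. It is a
meaningful spectral projection when `f` is continuous, that is locally constant, on the
spectrum. -/
noncomputable def levelProjection (b : A) (f : ℝ → ℕ) (k : ℕ) : A :=
  cfc (fun x => if f x = k then (1 : ℝ) else 0) b

lemma ContinuousOn.comp_level {b : A} {f : ℝ → ℕ} (hf : ContinuousOn f (spectrum ℝ b))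
    (g : ℕ → ℝ) : ContinuousOn (fun x => g (f x)) (spectrum ℝ b) :=
  (continuous_of_discreteTopology (f := g)).comp_continuousOn hf

lemma levelProjection_mul {b : A} {f : ℝ → ℕ} (hf : ContinuousOn f (spectrum ℝ b)) (j k : ℕ) :
    levelProjection b f j * levelProjection b f k =
      if j = k then levelProjection b f k else 0 := by
  rw [levelProjection, levelProjection, ← cfc_mul _ _ b
    (hf.comp_level fun l => if l = j then 1 else 0)
    (hf.comp_level fun l => if l = k then 1 else 0)]
  split_ifs with hjk
  · subst hjk
    congr 1
    ext x
    split_ifs <;> simp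
  · rw [← cfc_const_zero ℝ b]
    congr 1
    ext x
    by_cases h : f x = j
    · rw [if_neg (h ▸ hjk : ¬ f x = k), mul_zero]
    · rw [if_neg h, zero_mul]

lemma isStarProjection_levelProjection {b : A} {f : ℝ → ℕ} (hf : ContinuousOn f (spectrum ℝ b))
    (k : ℕ) : IsStarProjection (levelProjection b f k) :=
  ⟨by rw [IsIdempotentElem, levelProjection_mul hf, if_pos rfl], cfc_predicate _ _⟩

lemma levelProjection_ne_zero {b : A} [Nontrivial A] (hb : IsSelfAdjoint b) {f : ℝ → ℕ}
    (hf : ContinuousOn f (spectrum ℝ b)) {x : ℝ} (hx : x ∈ spectrum ℝ b) :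
    levelProjection b f (f x) ≠ 0 := by
  intro h0
  have h1 : (1 : ℝ) ∈ spectrum ℝ (levelProjection b f (f x)) := by
    rw [levelProjection, cfc_map_spectrum _ b hb
      (hf.comp_level fun l => if l = f x then 1 else 0)]
    exact ⟨x, hx, if_pos rfl⟩
  rw [h0, spectrum.zero_eq] at h1
  exact one_ne_zero h1

lemma norm_sub_sum_levelProjection_le {b : A} (hb : IsSelfAdjoint b) {f : ℝ → ℕ}
    (hf : ContinuousOn f (spectrum ℝ b)) {n : ℕ} {h C : ℝ} (hC : 0 ≤ C)
    (hfn : ∀ x ∈ spectrum ℝ b, f x ≤ n) (hfC : ∀ x ∈ spectrum ℝ b, |x - f x * h| ≤ C) :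
    ‖b - ∑ k ∈ Finset.range (n + 1), ((k * h : ℝ) : ℂ) • levelProjection b f k‖ ≤ C := by
  have hg : ∀ k, ContinuousOn (fun x => if f x = k then (1 : ℝ) else 0) (spectrum ℝ b) :=
    fun k => hf.comp_level fun l => if l = k then 1 else 0
  have hsum : ∑ k ∈ Finset.range (n + 1), ((k * h : ℝ) : ℂ) • levelProjection b f k =
      cfc (fun x => (f x : ℝ) * h) b := by
    have hterm : ∀ k : ℕ, ((k * h : ℝ) : ℂ) • levelProjection b f k =
        cfc (fun x => (k * h : ℝ) • if f x = k then (1 : ℝ) else 0) b := fun k => by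
      rw [Complex.coe_smul, levelProjection, cfc_smul (k * h : ℝ) _ b (hg k)]
    simp only [hterm]
    rw [← cfc_sum (fun (k : ℕ) x => (k * h : ℝ) • if f x = k then (1 : ℝ) else 0) b _
      fun k _ => hf.comp_level fun l => (k * h : ℝ) • if l = k then (1 : ℝ) else 0]
    refine cfc_congr fun x hx => ?_
    rw [Finset.sum_apply, Finset.sum_eq_single_of_mem (f x)
      (Finset.mem_range.2 (Nat.lt_succ_of_le (hfn x hx))) fun k _ hk => by simp [hk.symm]]
    simp
  rw [hsum]
  nth_rewrite 1 [← cfc_id' ℝ b]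
  rw [← cfc_sub (fun x => x) _ b continuousOn_id (hf.comp_level fun l => (l : ℝ) * h)]
  exact norm_cfc_le hC fun x hx => hfC x hx

end SpectralRounding

/-! ### Nilpotent and quasinilpotent approximation of positive elements -/

section Main

variable {A : Type*} [CStarAlgebra A]

lemma IsNilpotent.spectrum_eq_singleton_zero [Nontrivial A] {x : A} (hx : IsNilpotent x) :
    spectrum ℂ x = {0} := by
  obtain ⟨n, hn⟩ := hx
  refine (spectrum.nonempty x).subset_singleton_iff.1 fun z hz => ?_
  have h := spectrum.pow_mem_pow x n hz
  rw [hn, spectrum.zero_eq] at h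
  exact eq_zero_of_pow_eq_zero h

lemma zero_mem_spectrum_of_mem_closure_quasinilpotentElements {a : A}
    (hcl : a ∈ closure (quasinilpotentElements A)) : (0 : ℂ) ∈ spectrum ℂ a := by
  rw [spectrum.zero_mem_iff]
  intro hu
  have hopen : IsOpen {x : A | IsUnit x} := Units.isOpen
  obtain ⟨q, hqu, hq⟩ := mem_closure_iff.1 hcl _ hopen hu
  have h0 : (0 : ℂ) ∈ spectrum ℂ q := by rw [show spectrum ℂ q = {0} from hq]; rfl
  exact (spectrum.zero_mem_iff ℂ).1 h0 hqu

variable [PartialOrder A] [StarOrderedRing A]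

lemma isConnected_spectrum_of_mem_closure_quasinilpotentElements {a : A} (ha : 0 ≤ a)
    (hcl : a ∈ closure (quasinilpotentElements A)) : IsConnected (spectrum ℂ a) := by
  have h0 := zero_mem_spectrum_of_mem_closure_quasinilpotentElements hcl
  have hsa := ha.isSelfAdjoint
  have hord : (spectrum ℝ a).OrdConnected := by
    refine ⟨fun x hx y hy z hz => ?_⟩
    rcases (spectrum_nonneg_of_nonneg ha hx).trans hz.1 |>.eq_or_lt with h | h
    · rw [← h]
      exact (spectrum.algebraMap_mem_iff ℂ).1 (by simpa using h0)
    · rcases hz.2.eq_or_lt with h' | h'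
      · rwa [h']
      · exact (spectrum.algebraMap_mem_iff ℂ).1
          (mem_spectrum_of_mem_closure_quasinilpotentElements hsa hcl h h'
            ((spectrum.algebraMap_mem_iff ℂ).2 hy))
  refine ⟨⟨0, h0⟩, ?_⟩
  rw [← hsa.spectrumRestricts.algebraMap_image]
  exact hord.isPreconnected.image _ Complex.continuous_ofReal.continuousOn

/-- The converse direction. When the spectrum is `[0, ‖a‖]`, perturb `a` to have gaps at the
midpoints of a grid and round it to the grid by spectral projections. Connectedness of the
spectrum of `a` guarantees that no level is empty, as `exists_isNilpotent_near_sum` requires. -/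
lemma mem_closure_nilpotentElements_of_isConnected_spectrum (hs : IsSimpleCStarAlgebra A)
    (hpi : IsPurelyInfinite A) {a : A} (ha : 0 ≤ a) (hconn : IsConnected (spectrum ℂ a))
    (h0 : (0 : ℂ) ∈ spectrum ℂ a) : a ∈ closure (nilpotentElements A) := by
  have := hs.1
  have hsa := ha.isSelfAdjoint
  rcases eq_or_ne a 0 with rfl | ha0
  · exact subset_closure IsNilpotent.zero
  have hM : 0 < ‖a‖ := norm_pos_iff.2 ha0
  have hspec : ∀ t : ℝ, 0 ≤ t → t ≤ ‖a‖ → t ∈ spectrum ℝ a := by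
    intro t ht htM
    have hpre : IsPreconnected (spectrum ℝ a) := by
      rw [← hsa.spectrumRestricts.image]
      exact hconn.isPreconnected.image _ Complex.continuous_re.continuousOn
    exact hpre.ordConnected.out ((spectrum.algebraMap_mem_iff ℂ).1 (by simpa using h0))
      (CStarAlgebra.norm_mem_spectrum_of_nonneg ha) ⟨ht, htM⟩
  refine Metric.mem_closure_iff.2 fun ε hε => ?_
  -- The total error is at most `h / 4 + (h / 2 + h / 4) + (h + h) = 3 h` for the mesh `h < ε / 4`.
  obtain ⟨n, hn⟩ := exists_nat_gt (4 * ‖a‖ / ε)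
  have hn0 : (0 : ℝ) < n := lt_of_le_of_lt (by positivity) hn
  obtain ⟨h, hh⟩ : ∃ h, h = ‖a‖ / n := ⟨_, rfl⟩
  have hh0 : 0 < h := hh ▸ div_pos hM hn0
  have hnh : n * h = ‖a‖ := by rw [hh, mul_div_cancel₀ _ hn0.ne']
  have hhε : 4 * h < ε := by
    rw [div_lt_iff₀ hε] at hn
    rw [hh, ← mul_div_assoc, div_lt_iff₀ hn0]
    linarith
  have hη : 0 < h / 4 := by positivity
  obtain ⟨b, hb, hab, hgap⟩ := exists_isSelfAdjoint_notMem_spectrum hs hpi hsa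
    ((Finset.range n).image fun j : ℕ => ((j : ℝ) + 1 / 2) * h) hη
  have hf : ContinuousOn (gridLevel n h) (spectrum ℝ b) := continuousOn_gridLevel fun j hj =>
    hgap _ (Finset.mem_image_of_mem _ (Finset.mem_range.2 hj))
  have hround : ∀ x ∈ spectrum ℝ b, |x - gridLevel n h x * h| ≤ h / 2 + h / 4 := by
    intro x hx
    obtain ⟨y, hy, hyx⟩ := exists_mem_spectrum_abs_sub_lt hsa (by rwa [norm_sub_rev]) hx
    have hy0 := spectrum_nonneg_of_nonneg ha hy
    have hyM : y ≤ ‖a‖ := by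
      have := spectrum.norm_le_norm_of_mem hy
      rwa [Real.norm_of_nonneg hy0] at this
    rw [abs_lt] at hyx
    exact abs_sub_gridLevel_le hh0 hη.le (by linarith) (by rw [hnh]; linarith)
  have hP0 : ∀ k < n, levelProjection b (gridLevel n h) k ≠ 0 := by
    intro k hk
    have hkn : (k : ℝ) * h ≤ ‖a‖ := by
      rw [← hnh]
      exact mul_le_mul_of_nonneg_right (by exact_mod_cast hk.le) hh0.le
    obtain ⟨x, hx, hxk⟩ := exists_mem_spectrum_abs_sub_lt hb hab
      (hspec (k * h) (by positivity) hkn)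
    have hkx : gridLevel n h x = k := by
      have h1 := hround x hx
      rw [abs_lt] at hxk
      rw [abs_le] at h1
      have h2 : (gridLevel n h x : ℝ) < k + 1 := by
        by_contra! hc
        nlinarith
      have h3 : (k : ℝ) < gridLevel n h x + 1 := by
        by_contra! hc
        nlinarith
      norm_cast at h2 h3
      omega
    rw [← hkx]
    exact levelProjection_ne_zero hb hf hx
  obtain ⟨N, hN, -, -, hNn⟩ := exists_isNilpotent_near_sum hs hpi hh0.le hh0 n
    (levelProjection b (gridLevel n h)) (fun k _ => isStarProjection_levelProjection hf k)
    (fun j _ k _ hjk => by rw [levelProjection_mul hf, if_neg hjk]) hP0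
  have hbn := norm_sub_sum_levelProjection_le (n := n) (h := h) hb hf (by positivity)
    (fun x _ => by rw [gridLevel_eq_min hh0]; exact min_le_left _ _) hround
  refine ⟨N, hN, ?_⟩
  rw [dist_eq_norm]
  have h1 := norm_sub_le_norm_sub_add_norm_sub a b N
  have h2 := norm_sub_le_norm_sub_add_norm_sub b (∑ k ∈ Finset.range (n + 1),
    ((k * h : ℝ) : ℂ) • levelProjection b (gridLevel n h) k) N
  linarith

end Main

theorem proposition2p5 {A : Type*} [CStarAlgebra A] [PartialOrder A] [StarOrderedRing A]
    (hsimple : IsSimpleCStarAlgebra A) (hpi : IsPurelyInfinite A) (a : A) (ha : 0 ≤ a) :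
    List.TFAE [
      a ∈ closure (nilpotentElements A),
      a ∈ closure (quasinilpotentElements A),
      IsConnected (spectrum ℂ a) ∧ (0 : ℂ) ∈ spectrum ℂ a] := by
  have := hsimple.1
  tfae_have 1 → 2 := fun h => closure_mono
    (fun x (hx : IsNilpotent x) => hx.spectrum_eq_singleton_zero) h
  tfae_have 2 → 3 := fun h => ⟨isConnected_spectrum_of_mem_closure_quasinilpotentElements ha h,
    zero_mem_spectrum_of_mem_closure_quasinilpotentElements h⟩
  tfae_have 3 → 1 := fun h =>
    mem_closure_nilpotentElements_of_isConnected_spectrum hsimple hpi ha h.1 h.2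
  tfae_finish
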